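/- Let $\mathbb K$ be a field of characteristic zero, let $M=\bigoplus_{i\in\mathbb Z}M^i$ be a graded Lie algebra over $\mathbb K$, and let $L,A\subset M$ be graded Lie subalgebras with $M=L\oplus A$ as graded spaces. Let $P:M\to A$ be the projection with kernel $L$. Let $\operatorname{Der}(M/L)$ be the graded Lie algebra of derivations $D$ of $M$ with $D(L)\subset L$, with the graded commutator as bracket. Let $SA=\bigoplus_{n\ge 0}A^{\odot n}$ be the symmetric coalgebra of $A$, $p:SA\to A$ the projection, and $\operatorname{Coder}(SA)$ the graded Lie algebra of its coderivations, with the graded commutator (the Nijenhuis–Richardson bracket) as bracket. Let $B_j$ be the Bernoulli numbers, $\frac{t}{e^t-1}=\sum_{j\ge0}\frac{B_j}{j!}t^j$, and let $\varepsilon(\sigma)$ denote the Koszul sign. For $m\in M$ define $\Phi(m)_n:A^{\odot n}\to A$ ($n\ge0$) by $\Phi(m)_0(1)=Pm$ and, for homogeneous $a_1,\dots,a_n\in A$, $n\geq 1$, $$\Phi(m)_n(a_1\odot\cdots\odot a_n)=\sum_{\sigma\in S_n}\varepsilon(\sigma)\sum_{k=0}^{n}\frac{B_{n-k}}{k!(n-k)!}\,[\cdots[P([\cdots[m,a_{\sigma(1)}]\cdots,a_{\sigma(k)}]),a_{\sigma(k+1)}]\cdots,a_{\sigma(n)}],$$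 and for $D\in\operatorname{Der}(M/L)$ define $\Phi(D)_n:A^{\odot n}\to A$ by $\Phi(D)_0=0$ and, for $n\ge1$, $$\Phi(D)_n(a_1\odot\cdots\odot a_n)=\sum_{\sigma\in S_n}\varepsilon(\sigma)\sum_{k=1}^{n}\frac{B_{n-k}}{k!(n-k)!}\,[\cdots[P([\cdots[Da_{\sigma(1)},a_{\sigma(2)}]\cdots,a_{\sigma(k)}]),a_{\sigma(k+1)}]\cdots,a_{\sigma(n)}].$$ Then there are unique coderivations $\Phi(m),\Phi(D)\in\operatorname{Coder}(SA)$ with these Taylor coefficients, i.e. $p\,\Phi(m)|_{A^{\odot n}}=\Phi(m)_n$ and $p\,\Phi(D)|_{A^{\odot n}}=\Phi(D)_n$ for all $n\ge0$; $\Phi(D)(1)=0$, so that $\Phi(D)$ lies in the coderivations of the reduced symmetric coalgebra; and for all $m,m_1,m_2\in M$ and $D,D_1,D_2\in\operatorname{Der}(M/L)$ $$[\Phi(m_1),\Phi(m_2)]=\Phi([m_1,m_2]),\qquad[\Phi(D_1),\Phi(D_2)]=\Phi([D_1,D_2]),\qquad[\Phi(D),\Phi(m)]=\Phi(Dm).$$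 Equivalently, the map $(D,m)\mapsto\Phi(D)+\Phi(m)$ from the semidirect product $\operatorname{Der}(M/L)\ltimes M$ to $\operatorname{Coder}(SA)$ is a morphism of graded Lie algebras. -/

import Mathlib

open scoped DirectSum TensorProduct

namespace HDB

/-! ### Graded Lie algebras -/

/-- A (`ℤ`-)graded Lie algebra structure on a `K`-vector space `M = ⨁ M^n`. -/
structure GradedLieAlgebra (K M : Type*) [Field K] [AddCommGroup M] [Module K M] where
  /-- the homogeneous components `M^n` -/
  gr : ℤ → Submodule K M
  isInternal : DirectSum.IsInternal gr
  /-- the bracket `[x, y]` -/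
  bracket : M →ₗ[K] M →ₗ[K] M
  bracket_mem : ∀ {i j : ℤ} {x y : M}, x ∈ gr i → y ∈ gr j → bracket x y ∈ gr (i + j)
  skew : ∀ {i j : ℤ} {x y : M}, x ∈ gr i → y ∈ gr j →
    bracket x y = -((-1 : K) ^ (i * j) • bracket y x)
  jacobi : ∀ {i j k : ℤ} {x y z : M}, x ∈ gr i → y ∈ gr j → z ∈ gr k →
    bracket x (bracket y z) =
      bracket (bracket x y) z + (-1 : K) ^ (i * j) • bracket y (bracket x z)

/-- A morphism of graded Lie algebras: a linear map that preserves degrees and brackets. -/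
def IsGradedLieHom {K M N : Type*} [Field K] [AddCommGroup M] [Module K M]
    [AddCommGroup N] [Module K N] (G : GradedLieAlgebra K M) (H : GradedLieAlgebra K N)
    (f : M →ₗ[K] N) : Prop :=
  (∀ (n : ℤ) (x : M), x ∈ G.gr n → f x ∈ H.gr n) ∧
    ∀ x y : M, f (G.bracket x y) = H.bracket (f x) (f y)

noncomputable instance {K M : Type*} [Field K] [AddCommGroup M] [Module K M]
    (G : GradedLieAlgebra K M) : DirectSum.Decomposition G.gr :=
  G.isInternal.chooseDecomposition

/-- A graded Lie subalgebra: a subspace which is the sum of its homogeneous components and is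
closed under the bracket. -/
structure GradedLieSubalgebra {K M : Type*} [Field K] [AddCommGroup M] [Module K M]
    (G : GradedLieAlgebra K M) where
  carrier : Submodule K M
  homogeneous : ∀ (n : ℤ) (x : M), x ∈ carrier → (DirectSum.decompose G.gr x n : M) ∈ carrier
  bracket_mem : ∀ x y : M, x ∈ carrier → y ∈ carrier → G.bracket x y ∈ carrier

/-- The induced grading `A^n = A ∩ M^n` of a graded Lie subalgebra `A` of `M`. -/
def GradedLieSubalgebra.gr {K M : Type*} [Field K] [AddCommGroup M] [Module K M]
    {G : GradedLieAlgebra K M} (A : GradedLieSubalgebra G) (n : ℤ) : Submodule K A.carrier :=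
  (G.gr n).comap A.carrier.subtype

theorem GradedLieSubalgebra.isInternal {K M : Type*} [Field K] [AddCommGroup M] [Module K M]
    {G : GradedLieAlgebra K M} (A : GradedLieSubalgebra G) : DirectSum.IsInternal A.gr := by
  classical
  rw [DirectSum.isInternal_submodule_iff_iSupIndep_and_iSup_eq_top]
  constructor
  · intro i
    rw [Submodule.disjoint_def]
    intro x hx hx'
    have h := Submodule.disjoint_def.1 (G.isInternal.submodule_iSupIndep i) (x : M) hx
    have h2 : (x : M) ∈ (⨆ j, ⨆ (_ : j ≠ i), A.gr j).map A.carrier.subtype := ⟨x, hx', rfl⟩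
    simp only [Submodule.map_iSup] at h2
    refine Subtype.ext (h ?_)
    refine (iSup₂_mono fun j _ => ?_ : _ ≤ ⨆ j, ⨆ (_ : j ≠ i), G.gr j) h2
    exact Submodule.map_comap_le _ _
  · rw [eq_top_iff]
    rintro x -
    have h : x = ∑ i ∈ (DirectSum.decompose G.gr (x : M)).support,
        (⟨(DirectSum.decompose G.gr (x : M) i : M), A.homogeneous i x x.2⟩ : A.carrier) := by
      apply Subtype.ext
      rw [AddSubmonoidClass.coe_finsetSum]
      exact (DirectSum.sum_support_decompose G.gr (x : M)).symm
    rw [h]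
    refine Submodule.sum_mem _ fun i _ => Submodule.mem_iSup_of_mem i ?_
    exact (DirectSum.decompose G.gr (x : M) i).2

noncomputable instance {K M : Type*} [Field K] [AddCommGroup M] [Module K M]
    {G : GradedLieAlgebra K M} (A : GradedLieSubalgebra G) : DirectSum.Decomposition A.gr :=
  A.isInternal.chooseDecomposition

/-! ### Graded Lie algebras of endomorphisms -/

section Commutator

variable {K V : Type*} [Field K] [AddCommGroup V] [Module K V]

/-- A family `S n` of spaces of endomorphisms ("of degree `n`") is closed under the graded
commutator `[f, g] = f g - (-1)^(|f||g|) g f`. -/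
def CommClosed (S : ℤ → Submodule K (Module.End K V)) : Prop :=
  ∀ (p q : ℤ) (f g : Module.End K V), f ∈ S p → g ∈ S q →
    f * g - (-1 : K) ^ (p * q) • (g * f) ∈ S (p + q)

variable (S : ℤ → Submodule K (Module.End K V)) (hS : CommClosed S)

/-- The graded commutator of homogeneous elements. -/
def commHom (p q : ℤ) : S p →ₗ[K] S q →ₗ[K] S (p + q) :=
  LinearMap.mk₂ K (fun f g => ⟨_, hS p q f g f.2 g.2⟩)
    (fun f f' g => Subtype.ext (by simp [add_mul, mul_add]; abel))
    (fun c f g => Subtype.ext (by simp [smul_sub, smul_comm c]))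
    (fun f g g' => Subtype.ext (by simp [add_mul, mul_add]; abel))
    (fun c f g => Subtype.ext (by simp [smul_sub, smul_comm c]))

/-- The bilinear extension of the graded commutator to `⨁ n, S n`. -/
noncomputable def commBracket : (⨁ n, S n) →ₗ[K] (⨁ n, S n) →ₗ[K] (⨁ n, S n) :=
  DirectSum.toModule K ℤ _ fun p =>
    (DirectSum.toModule K ℤ _ fun q =>
      ((commHom S hS p q).compr₂ (DirectSum.lof K ℤ (fun n => S n) (p + q))).flip).flip

theorem commBracket_lof {p q : ℤ} (f : S p) (g : S q) :
    commBracket S hS (DirectSum.lof K ℤ (fun n => S n) p f)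
      (DirectSum.lof K ℤ (fun n => S n) q g) =
      DirectSum.lof K ℤ (fun n => S n) (p + q) (commHom S hS p q f g) := by
  simp [commBracket]

theorem lof_ext {p q : ℤ} (h : p = q) (f : S p) (g : S q)
    (hfg : (f : Module.End K V) = g) :
    DirectSum.lof K ℤ (fun n => S n) p f = DirectSum.lof K ℤ (fun n => S n) q g := by
  subst h
  rw [Subtype.ext hfg]

theorem isInternal_range_lof :
    DirectSum.IsInternal fun n => LinearMap.range (DirectSum.lof K ℤ (fun n => S n) n) := by
  let R : ℤ → Submodule K (⨁ n, S n) := fun n =>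
    LinearMap.range (DirectSum.lof K ℤ (fun n => S n) n)
  let _ : DirectSum.Decomposition R := DirectSum.Decomposition.ofLinearMap R
    (DirectSum.toModule K ℤ _ fun n =>
      DirectSum.lof K ℤ (fun n => R n) n ∘ₗ (DirectSum.lof K ℤ (fun n => S n) n).rangeRestrict)
    (by ext n x : 2; simp [R])
    (by
      ext n ⟨_, x, rfl⟩ : 2
      simp [R]
      rfl)
  exact DirectSum.Decomposition.isInternal R

/-- The graded Lie algebra `⨁ n, S n` with the graded commutator as bracket. -/
noncomputable def commLie : GradedLieAlgebra K (⨁ n, S n) where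
  gr n := LinearMap.range (DirectSum.lof K ℤ (fun n => S n) n)
  isInternal := isInternal_range_lof S
  bracket := commBracket S hS
  bracket_mem := by
    rintro i j _ _ ⟨f, rfl⟩ ⟨g, rfl⟩
    rw [commBracket_lof]
    exact ⟨_, rfl⟩
  skew := by
    rintro i j _ _ ⟨f, rfl⟩ ⟨g, rfl⟩
    rw [commBracket_lof, commBracket_lof, ← map_smul, ← map_neg]
    apply lof_ext S (add_comm i j)
    have h : (-1 : K) ^ (i * j) * (-1 : K) ^ (i * j) = 1 := by
      rw [← mul_zpow]; simp
    simp only [commHom, LinearMap.mk₂_apply, Submodule.coe_neg, Submodule.coe_smul, smul_sub,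
      smul_smul, mul_comm j i, h]
    module
  jacobi := by
    rintro i j k _ _ _ ⟨f, rfl⟩ ⟨g, rfl⟩ ⟨h, rfl⟩
    have h0 : (-1 : K) ≠ 0 := by simp
    have h1 : (-1 : K) ^ (i * j) * (-1 : K) ^ (i * j) = 1 := by
      rw [← mul_zpow]; simp
    have e : DirectSum.lof K ℤ (fun n => S n) (j + (i + k))
        (commHom S hS j (i + k) g (commHom S hS i k f h)) =
        DirectSum.lof K ℤ (fun n => S n) (i + j + k)
          ⟨_, (by rw [show i + j + k = j + (i + k) by ring]; exact
            (commHom S hS j (i + k) g (commHom S hS i k f h)).2)⟩ :=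
      lof_ext S (by ring) _ _ rfl
    simp only [commBracket_lof]
    rw [e, ← map_smul, ← map_add]
    apply lof_ext S (add_assoc i j k).symm
    simp only [commHom, LinearMap.mk₂_apply, Submodule.coe_add, Submodule.coe_smul, smul_sub,
      mul_add, add_mul, zpow_add₀ h0, mul_sub, sub_mul, smul_mul_assoc, mul_smul_comm,
      smul_smul, mul_comm j i, mul_assoc]
    set a := (-1 : K) ^ (i * j)
    set b := (-1 : K) ^ (i * k)
    set c := (-1 : K) ^ (j * k)
    match_scalars <;> first | ring1 | linear_combination c * h1 | linear_combination (-(b * c)) * h1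

/-- Instance shortcut. -/
noncomputable instance : AddCommGroup (⨁ n, S n) := DirectSum.instAddCommGroup

/-- The underlying endomorphism of an element of `⨁ n, S n`. -/
noncomputable def toEnd : (⨁ n, S n) →ₗ[K] Module.End K V := DirectSum.coeLinearMap S

end Commutator

/-! ### Derivations -/

section Derivations

variable {K M : Type*} [Field K] [AddCommGroup M] [Module K M]

/-- `Der^n(M/L)`: the derivations `D` of degree `n` of the graded Lie algebra `M` such that
`D L ⊆ L`. -/
def derComp {G : GradedLieAlgebra K M} (L : GradedLieSubalgebra G) (n : ℤ) :
    Submodule K (Module.End K M) where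
  carrier := {D | (∀ (i : ℤ) (x : M), x ∈ G.gr i → D x ∈ G.gr (n + i)) ∧
    (∀ (i : ℤ) (x y : M), x ∈ G.gr i →
      D (G.bracket x y) = G.bracket (D x) y + (-1 : K) ^ (n * i) • G.bracket x (D y)) ∧
    ∀ x ∈ L.carrier, D x ∈ L.carrier}
  add_mem' := by
    rintro D E ⟨h1, h2, h3⟩ ⟨h1', h2', h3'⟩
    refine ⟨fun i x hx => add_mem (h1 i x hx) (h1' i x hx), fun i x y hx => ?_,
      fun x hx => add_mem (h3 x hx) (h3' x hx)⟩
    simp only [LinearMap.add_apply, h2 i x y hx, h2' i x y hx, map_add, smul_add]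
    abel
  zero_mem' := by simp
  smul_mem' := by
    rintro c D ⟨h1, h2, h3⟩
    refine ⟨fun i x hx => Submodule.smul_mem _ _ (h1 i x hx), fun i x y hx => ?_,
      fun x hx => Submodule.smul_mem _ _ (h3 x hx)⟩
    simp only [LinearMap.smul_apply, h2 i x y hx, map_smul, smul_add, smul_comm c]

theorem derComp_closed {G : GradedLieAlgebra K M} (L : GradedLieSubalgebra G) :
    CommClosed (derComp L) := by
  rintro p q D E ⟨h1, h2, h3⟩ ⟨h1', h2', h3'⟩
  have h0 : (-1 : K) ≠ 0 := by simp
  have hs : (-1 : K) ^ (p * q) * (-1 : K) ^ (p * q) = 1 := by rw [← mul_zpow]; simp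
  refine ⟨fun i x hx => ?_, fun i x y hx => ?_, fun x hx => ?_⟩
  · have e1 := h1 _ _ (h1' i x hx)
    have e2 := h1' _ _ (h1 i x hx)
    rw [← add_assoc] at e1 e2
    rw [add_comm q p] at e2
    exact sub_mem e1 (Submodule.smul_mem _ _ e2)
  · simp only [LinearMap.sub_apply, LinearMap.smul_apply, Module.End.mul_apply, h2' i x _ hx,
      h2 i x _ hx, map_add, map_smul, h2 _ _ _ (h1' i x hx), h2' _ _ _ (h1 i x hx), map_sub,
      mul_add, add_mul, zpow_add₀ h0, mul_comm q p]
    set a := (-1 : K) ^ (p * q)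
    set b := (-1 : K) ^ (p * i)
    set c := (-1 : K) ^ (q * i)
    match_scalars <;> first | ring1 | linear_combination c * hs | linear_combination (-c) * hs
  · exact sub_mem (h3 _ (h3' x hx)) (Submodule.smul_mem _ _ (h3' _ (h3 x hx)))

/-- The underlying space of `Der(M/L) = ⨁ n, Der^n(M/L)`. -/
abbrev Der {G : GradedLieAlgebra K M} (L : GradedLieSubalgebra G) : Type _ :=
  ⨁ n, derComp L n

/-- The graded Lie algebra `Der(M/L)`, with the graded commutator as bracket. -/
noncomputable def derLie {G : GradedLieAlgebra K M} (L : GradedLieSubalgebra G) :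
    GradedLieAlgebra K (Der L) :=
  commLie (derComp L) (derComp_closed L)

end Derivations

/-! ### The symmetric coalgebra of a graded space and its coderivations -/

section Symmetric

variable {K V : Type*} [Field K] [AddCommGroup V] [Module K V]

/-- The map `x ↦ (-1)^(n |x|) x`. -/
noncomputable def twist (𝒱 : ℤ → Submodule K V) [DirectSum.Decomposition 𝒱] (n : ℤ) :
    V →ₗ[K] V :=
  DirectSum.toModule K ℤ V (fun i => (-1 : K) ^ (n * i) • (𝒱 i).subtype) ∘ₗ
    (DirectSum.decomposeLinearEquiv 𝒱).toLinearMap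

theorem twist_of_mem (𝒱 : ℤ → Submodule K V) [DirectSum.Decomposition 𝒱] (n : ℤ) {i : ℤ}
    {x : V} (hx : x ∈ 𝒱 i) : twist 𝒱 n x = (-1 : K) ^ (n * i) • x := by
  lift x to 𝒱 i using hx
  simp [twist]

variable (𝒱 : ℤ → Submodule K V)

/-- The Koszul relations `v ⊗ w = (-1)^(|v||w|) w ⊗ v`. -/
inductive SymRel : TensorAlgebra K V → TensorAlgebra K V → Prop
  | swap {i j : ℤ} {v w : V} (hv : v ∈ 𝒱 i) (hw : w ∈ 𝒱 j) :
      SymRel (TensorAlgebra.ι K v * TensorAlgebra.ι K w)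
        ((-1 : K) ^ (i * j) • (TensorAlgebra.ι K w * TensorAlgebra.ι K v))

/-- `SV = ⨁ V^{⊙ n}`: the quotient of the tensor algebra by the Koszul relations, so that
`V^{⊙ n}` is the space of coinvariants of `V^{⊗ n}` under the symmetric group. Its product
is `⊙`. -/
def SymCoalg : Type _ := RingQuot (SymRel 𝒱)

noncomputable instance : Ring (SymCoalg 𝒱) := inferInstanceAs (Ring (RingQuot (SymRel 𝒱)))

noncomputable instance : Algebra K (SymCoalg 𝒱) := inferInstanceAs (Algebra K (RingQuot (SymRel 𝒱)))

namespace SymCoalg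

/-- The inclusion `V = V^{⊙ 1} → SV`. -/
noncomputable def ι : V →ₗ[K] SymCoalg 𝒱 :=
  (RingQuot.mkAlgHom K (SymRel 𝒱)).toLinearMap ∘ₗ TensorAlgebra.ι K

theorem ι_mul_ι {i j : ℤ} {v w : V} (hv : v ∈ 𝒱 i) (hw : w ∈ 𝒱 j) :
    ι 𝒱 v * ι 𝒱 w = (-1 : K) ^ (i * j) • (ι 𝒱 w * ι 𝒱 v) := by
  have h := RingQuot.mkAlgHom_rel K (SymRel.swap hv hw)
  rw [map_smul, map_mul, map_mul] at h
  exact h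

/-- Algebra maps out of `SV`. -/
noncomputable def lift {B : Type*} [Semiring B] [Algebra K B] (f : V →ₗ[K] B)
    (hf : ∀ (i j : ℤ) (v w : V), v ∈ 𝒱 i → w ∈ 𝒱 j →
      f v * f w = (-1 : K) ^ (i * j) • (f w * f v)) : SymCoalg 𝒱 →ₐ[K] B :=
  RingQuot.liftAlgHom K ⟨TensorAlgebra.lift K f, by
    rintro _ _ ⟨hv, hw⟩
    simpa using hf _ _ _ _ hv hw⟩

theorem lift_ι {B : Type*} [Semiring B] [Algebra K B] (f : V →ₗ[K] B)
    (hf : ∀ (i j : ℤ) (v w : V), v ∈ 𝒱 i → w ∈ 𝒱 j →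
      f v * f w = (-1 : K) ^ (i * j) • (f w * f v)) (v : V) :
    lift 𝒱 f hf (ι 𝒱 v) = f v := by
  have : lift 𝒱 f hf (ι 𝒱 v) = TensorAlgebra.lift K f (TensorAlgebra.ι K v) :=
    RingQuot.liftAlgHom_mkAlgHom_apply _ _ _ _
  rw [this, TensorAlgebra.lift_ι_apply]

theorem hom_ext {B : Type*} [Semiring B] [Algebra K B] {f g : SymCoalg 𝒱 →ₐ[K] B}
    (h : ∀ v, f (ι 𝒱 v) = g (ι 𝒱 v)) : f = g := by
  apply RingQuot.ringQuot_ext'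
  apply TensorAlgebra.hom_ext
  ext v
  exact h v

/-- The component `(SV)^n` of total degree `n`, spanned by the products `v₁ ⊙ ⋯ ⊙ v_k` with
`|v₁| + ⋯ + |v_k| = n`. -/
noncomputable def gr (n : ℤ) : Submodule K (SymCoalg 𝒱) :=
  Submodule.span K {x | ∃ l : List (ℤ × V), (∀ p ∈ l, p.2 ∈ 𝒱 p.1) ∧
    (l.map Prod.fst).sum = n ∧ (l.map fun p => ι 𝒱 p.2).prod = x}

theorem ι_mem {i : ℤ} {v : V} (hv : v ∈ 𝒱 i) : ι 𝒱 v ∈ gr 𝒱 i :=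
  Submodule.subset_span ⟨[(i, v)], by simpa using hv, by simp, by simp⟩

noncomputable instance gradedMonoid : SetLike.GradedMonoid (gr 𝒱) where
  one_mem := Submodule.subset_span ⟨[], by simp⟩
  mul_mem := by
    intro i j x y hx hy
    have h := Submodule.mul_mem_mul hx hy
    rw [gr, gr, Submodule.span_mul_span] at h
    refine Submodule.span_mono ?_ h
    rintro _ ⟨_, ⟨l, h1, h2, rfl⟩, _, ⟨l', h1', h2', rfl⟩, rfl⟩
    refine ⟨l ++ l', ?_, by simp [h2, h2'], by simp⟩
    intro p hp
    rcases List.mem_append.1 hp with hp | hp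
    exacts [h1 p hp, h1' p hp]

variable [DirectSum.Decomposition 𝒱]

/-- Auxiliary: the inclusion of `V` into the sum of the components of `SV`. -/
noncomputable def grι : V →ₗ[K] ⨁ n, gr 𝒱 n :=
  DirectSum.toModule K ℤ _ (fun i => DirectSum.lof K ℤ (fun n => gr 𝒱 n) i ∘ₗ
    (ι 𝒱 ∘ₗ (𝒱 i).subtype).codRestrict (gr 𝒱 i) (fun v => ι_mem 𝒱 v.2)) ∘ₗ
    (DirectSum.decomposeLinearEquiv 𝒱).toLinearMap

theorem grι_of_mem {i : ℤ} {v : V} (hv : v ∈ 𝒱 i) :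
    grι 𝒱 v = DirectSum.of (fun n => gr 𝒱 n) i ⟨ι 𝒱 v, ι_mem 𝒱 hv⟩ := by
  lift v to 𝒱 i using hv
  simp [grι, ← DirectSum.lof_eq_of K]
  rfl

theorem grι_comm (i j : ℤ) (v w : V) (hv : v ∈ 𝒱 i) (hw : w ∈ 𝒱 j) :
    grι 𝒱 v * grι 𝒱 w = (-1 : K) ^ (i * j) • (grι 𝒱 w * grι 𝒱 v) := by
  rw [grι_of_mem 𝒱 hv, grι_of_mem 𝒱 hw, DirectSum.of_mul_of, DirectSum.of_mul_of,
    ← DirectSum.lof_eq_of K, ← DirectSum.lof_eq_of K, ← map_smul, DirectSum.lof_eq_of,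
    DirectSum.lof_eq_of]
  exact DirectSum.of_eq_of_gradedMonoid_eq
    (Sigma.subtype_ext (add_comm i j) (ι_mul_ι 𝒱 hv hw))

noncomputable instance : GradedAlgebra (gr 𝒱) :=
  GradedAlgebra.ofAlgHom (gr 𝒱) (lift 𝒱 (grι 𝒱) (grι_comm 𝒱))
    (by
      apply hom_ext
      intro v
      induction v using DirectSum.Decomposition.inductionOn 𝒱 with
      | zero => simp
      | homogeneous v =>
        simp [lift_ι, grι_of_mem 𝒱 v.2]
      | add v w hv hw => simp only [map_add, hv, hw])
    (by
      rintro n ⟨x, hx⟩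
      induction hx using Submodule.span_induction with
      | mem x hx =>
        obtain ⟨l, h1, rfl, rfl⟩ := hx
        induction l with
        | nil => simp; rfl
        | cons p l ih =>
          have hp : p.2 ∈ 𝒱 p.1 := h1 p (by simp)
          have ih' := ih fun q hq => h1 q (by simp [hq])
          simp only [List.map_cons, List.prod_cons, map_mul, lift_ι] at ih' ⊢
          rw [ih', grι_of_mem 𝒱 hp, DirectSum.of_mul_of]
          exact DirectSum.of_eq_of_gradedMonoid_eq (Sigma.subtype_ext (by exact List.sum_cons.symm) rfl)
      | zero => simp; exact (map_zero (DirectSum.of (fun n => gr 𝒱 n) n)).symm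
      | add x y hx hy ihx ihy =>
        simp only [map_add] at *
        rw [ihx, ihy, ← map_add]; rfl
      | smul c x hx ih =>
        simp only [map_smul] at *
        rw [ih, ← DirectSum.lof_eq_of K, ← map_smul]; rfl)

/-- The comultiplication `SV → SV ⊗ SV` as an algebra map; the product of the target is
`(a ⊗ b)(a' ⊗ b') = (-1)^(|b||a'|) a a' ⊗ b b'`. It is determined by `v ↦ v ⊗ 1 + 1 ⊗ v`. -/
noncomputable def comulAlgHom : SymCoalg 𝒱 →ₐ[K] (gr 𝒱 ᵍ⊗[K] gr 𝒱) :=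
  lift 𝒱 ((GradedTensorProduct.includeLeft (gr 𝒱) (gr 𝒱)).toLinearMap ∘ₗ ι 𝒱 +
      (GradedTensorProduct.includeRight (gr 𝒱) (gr 𝒱)).toLinearMap ∘ₗ ι 𝒱) (by
    intro i j v w hv hw
    have key : ∀ (i j : ℤ) (v w : V), v ∈ 𝒱 i → w ∈ 𝒱 j →
        (GradedTensorProduct.includeRight (gr 𝒱) (gr 𝒱)) (ι 𝒱 v) *
          (GradedTensorProduct.includeLeft (gr 𝒱) (gr 𝒱)) (ι 𝒱 w) =
        (-1 : K) ^ (i * j) • ((GradedTensorProduct.includeLeft (gr 𝒱) (gr 𝒱)) (ι 𝒱 w) *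
          (GradedTensorProduct.includeRight (gr 𝒱) (gr 𝒱)) (ι 𝒱 v)) := by
      intro i j v w hv hw
      have h := GradedTensorProduct.tmul_coe_mul_coe_tmul (R := K) (gr 𝒱) (gr 𝒱) 1
        ⟨ι 𝒱 v, ι_mem 𝒱 hv⟩ ⟨ι 𝒱 w, ι_mem 𝒱 hw⟩ 1
      have h' := GradedTensorProduct.tmul_one_mul_one_tmul (R := K) (gr 𝒱) (gr 𝒱) (ι 𝒱 w) (ι 𝒱 v)
      rw [one_mul, mul_one, ← h'] at h
      refine h.trans ?_
      rcases Int.even_or_odd (i * j) with hij | hij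
      · rw [show (-1 : K) ^ (i * j) = 1 from hij.neg_one_zpow, one_smul, show (-1 : ℤˣ) ^ (i * j) = 1 from hij.neg_one_zpow,
          one_smul]
        rfl
      · rw [show (-1 : K) ^ (i * j) = -1 from hij.neg_one_zpow, show (-1 : ℤˣ) ^ (i * j) = -1 from hij.neg_one_zpow,
          neg_smul, one_smul, Units.neg_smul, one_smul]
        rfl
    have hs : (-1 : K) ^ (i * j) * (-1 : K) ^ (i * j) = 1 := by rw [← mul_zpow]; simp
    simp only [LinearMap.add_apply, LinearMap.comp_apply, AlgHom.toLinearMap_apply, mul_add,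
      add_mul, ← map_mul, ι_mul_ι 𝒱 hv hw, map_smul, smul_add]
    rw [key i j v w hv hw, key j i w v hw hv, smul_smul, mul_comm j i, hs, one_smul]
    abel)

/-- The comultiplication `Δ : SV → SV ⊗ SV`. -/
noncomputable def comul : SymCoalg 𝒱 →ₗ[K] SymCoalg 𝒱 ⊗[K] SymCoalg 𝒱 :=
  (GradedTensorProduct.of K (gr 𝒱) (gr 𝒱)).symm.toLinearMap ∘ₗ (comulAlgHom 𝒱).toLinearMap

/-- The projection `p : SV → V^{⊙ 1} = V`. -/
noncomputable def proj : SymCoalg 𝒱 →ₗ[K] V :=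
  letI : Module Kᵐᵒᵖ V := Module.compHom _ ((RingHom.id K).fromOpposite mul_comm)
  haveI : IsCentralScalar K V := ⟨fun _ _ => rfl⟩
  TrivSqZeroExt.sndHom K V ∘ₗ
    (lift 𝒱 (B := TrivSqZeroExt K V) (TrivSqZeroExt.inrHom K V) (by simp)).toLinearMap

end SymCoalg

/-- `Coder^n(SV)`: the coderivations of degree `n` of the graded coalgebra `SV`, that is, the
linear maps `Q` of degree `n` with `Δ Q = (Q ⊗ id + id ⊗ Q) Δ`, where
`(id ⊗ Q)(x ⊗ y) = (-1)^(n |x|) x ⊗ Q y`. -/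
noncomputable def coderComp [DirectSum.Decomposition 𝒱] (n : ℤ) :
    Submodule K (Module.End K (SymCoalg 𝒱)) where
  carrier := {Q |
    (∀ (i : ℤ) (x : SymCoalg 𝒱), x ∈ SymCoalg.gr 𝒱 i → Q x ∈ SymCoalg.gr 𝒱 (n + i)) ∧
    SymCoalg.comul 𝒱 ∘ₗ Q =
      (TensorProduct.map Q LinearMap.id + TensorProduct.map (twist (SymCoalg.gr 𝒱) n) Q) ∘ₗ
        SymCoalg.comul 𝒱}
  add_mem' := by
    rintro Q R ⟨h1, h2⟩ ⟨h1', h2'⟩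
    refine ⟨fun i x hx => add_mem (h1 i x hx) (h1' i x hx), ?_⟩
    rw [LinearMap.comp_add, h2, h2', TensorProduct.map_add_left, TensorProduct.map_add_right,
      ← LinearMap.add_comp]
    congr 1
    abel
  zero_mem' := by simp
  smul_mem' := by
    rintro c Q ⟨h1, h2⟩
    refine ⟨fun i x hx => Submodule.smul_mem _ _ (h1 i x hx), ?_⟩
    rw [LinearMap.comp_smul, h2, TensorProduct.map_smul_left, TensorProduct.map_smul_right,
      ← smul_add, LinearMap.smul_comp]

theorem twist_comp_of_degree [DirectSum.Decomposition 𝒱] (p q : ℤ) (f : Module.End K V)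
    (hf : ∀ (i : ℤ) (x : V), x ∈ 𝒱 i → f x ∈ 𝒱 (q + i)) :
    twist 𝒱 p ∘ₗ f = (-1 : K) ^ (p * q) • (f ∘ₗ twist 𝒱 p) := by
  refine DirectSum.decompose_lhom_ext 𝒱 fun i => ?_
  ext x
  simp only [LinearMap.comp_apply, Submodule.subtype_apply, LinearMap.smul_apply,
    twist_of_mem 𝒱 p x.2, twist_of_mem 𝒱 p (hf i x x.2), map_smul, smul_smul, mul_add,
    zpow_add₀ (show (-1 : K) ≠ 0 by simp)]

theorem twist_comp_twist [DirectSum.Decomposition 𝒱] (p q : ℤ) :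
    twist 𝒱 p ∘ₗ twist 𝒱 q = twist 𝒱 (p + q) := by
  refine DirectSum.decompose_lhom_ext 𝒱 fun i => ?_
  ext x
  simp only [LinearMap.comp_apply, Submodule.subtype_apply,
    twist_of_mem 𝒱 _ x.2, map_smul, smul_smul, add_mul, mul_comm ((-1 : K) ^ (q * i)),
    zpow_add₀ (show (-1 : K) ≠ 0 by simp)]

theorem coderComp_closed [DirectSum.Decomposition 𝒱] : CommClosed (coderComp 𝒱) := by
  rintro p q Q R ⟨h1, h2⟩ ⟨h1', h2'⟩
  have hs : (-1 : K) ^ (p * q) * (-1 : K) ^ (p * q) = 1 := by rw [← mul_zpow]; simp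
  refine ⟨fun i x hx => ?_, ?_⟩
  · have e1 := h1 _ _ (h1' i x hx)
    have e2 := h1' _ _ (h1 i x hx)
    rw [← add_assoc] at e1 e2
    rw [add_comm q p] at e2
    exact sub_mem e1 (Submodule.smul_mem _ _ e2)
  · have t1 := twist_comp_of_degree (SymCoalg.gr 𝒱) p q R h1'
    have t2 := twist_comp_of_degree (SymCoalg.gr 𝒱) q p Q h1
    have t3 := twist_comp_twist (SymCoalg.gr 𝒱) p q
    have t4 := twist_comp_twist (SymCoalg.gr 𝒱) q p
    have c1 : SymCoalg.comul 𝒱 ∘ₗ (Q ∘ₗ R) = (TensorProduct.map Q LinearMap.id +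
        TensorProduct.map (twist (SymCoalg.gr 𝒱) p) Q) ∘ₗ ((TensorProduct.map R LinearMap.id +
        TensorProduct.map (twist (SymCoalg.gr 𝒱) q) R) ∘ₗ SymCoalg.comul 𝒱) := by
      rw [← LinearMap.comp_assoc, h2, LinearMap.comp_assoc, h2']
    have c2 : SymCoalg.comul 𝒱 ∘ₗ (R ∘ₗ Q) = (TensorProduct.map R LinearMap.id +
        TensorProduct.map (twist (SymCoalg.gr 𝒱) q) R) ∘ₗ ((TensorProduct.map Q LinearMap.id +
        TensorProduct.map (twist (SymCoalg.gr 𝒱) p) Q) ∘ₗ SymCoalg.comul 𝒱) := by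
      rw [← LinearMap.comp_assoc, h2', LinearMap.comp_assoc, h2]
    rw [Module.End.mul_eq_comp, Module.End.mul_eq_comp, LinearMap.comp_sub, LinearMap.comp_smul,
      c1, c2, ← LinearMap.comp_assoc, ← LinearMap.comp_assoc, ← LinearMap.smul_comp,
      ← LinearMap.sub_comp]
    congr 1
    simp only [LinearMap.add_comp, LinearMap.comp_add, ← TensorProduct.map_comp,
      LinearMap.id_comp, LinearMap.comp_id, t1, t2, t3, t4, mul_comm q p, add_comm q p,
      TensorProduct.map_smul_left, TensorProduct.map_smul_right, smul_add, smul_smul, hs,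
      one_smul, sub_eq_add_neg, TensorProduct.map_add_left, TensorProduct.map_add_right,
      ← neg_one_smul K (_ • _)]
    module

/-- The underlying space of `Coder(SV) = ⨁ n, Coder^n(SV)`. -/
abbrev Coder [DirectSum.Decomposition 𝒱] : Type _ := ⨁ n, coderComp 𝒱 n

/-- The graded Lie algebra `Coder(SV)`; the (Nijenhuis-Richardson) bracket is the graded commutator
of coderivations. -/
noncomputable def coderLie [DirectSum.Decomposition 𝒱] : GradedLieAlgebra K (Coder 𝒱) :=
  commLie (coderComp 𝒱) (coderComp_closed 𝒱)

end Symmetric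

/-! ### The semidirect product `Der(M/L) ⋉ M` -/

section Semidirect

variable {K M : Type*} [Field K] [AddCommGroup M] [Module K M] {G : GradedLieAlgebra K M}
variable (L : GradedLieSubalgebra G)

/-- The bilinear extension of `(D, m) ↦ (-1)^(|D||m|) D m`. -/
noncomputable def twistedAct : Der L →ₗ[K] Module.End K M :=
  DirectSum.toModule K ℤ _ fun p =>
    LinearMap.mulRight K (twist G.gr p) ∘ₗ (derComp L p).subtype

theorem twistedAct_lof {p i : ℤ} (D : derComp L p) {m : M} (hm : m ∈ G.gr i) :
    twistedAct L (DirectSum.lof K ℤ (fun n => derComp L n) p D) m =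
      (-1 : K) ^ (p * i) • (D : Module.End K M) m := by
  simp [twistedAct, twist_of_mem G.gr p hm]

/-- The bracket of the semidirect product:
`[(D, m), (E, n)] = ([D, E], [m, n] + D n - (-1)^(|m||E|) E m)`. -/
noncomputable def semidirectBracket : Der L × M →ₗ[K] Der L × M →ₗ[K] Der L × M :=
  LinearMap.mk₂ K
    (fun x y => ((derLie L).bracket x.1 y.1,
      G.bracket x.2 y.2 + toEnd (derComp L) x.1 y.2 - twistedAct L y.1 x.2))
    (fun x x' y => Prod.ext (by simp) (by simp; abel))
    (fun c x y => Prod.ext (by simp) (by simp [smul_sub]))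
    (fun x y y' => Prod.ext (by simp) (by simp; abel))
    (fun c x y => Prod.ext (by simp) (by simp [smul_sub]))

theorem semidirect_isInternal :
    DirectSum.IsInternal fun n => ((derLie L).gr n).prod (G.gr n) := by
  rw [DirectSum.isInternal_submodule_iff_iSupIndep_and_iSup_eq_top]
  constructor
  · intro i
    rw [Submodule.disjoint_def]
    intro x hx hx'
    have h1 := Submodule.disjoint_def.1 ((derLie L).isInternal.submodule_iSupIndep i) x.1 hx.1
    have h2 := Submodule.disjoint_def.1 (G.isInternal.submodule_iSupIndep i) x.2 hx.2
    have e1 := Submodule.mem_map_of_mem (f := LinearMap.fst K (Der L) M) hx'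
    have e2 := Submodule.mem_map_of_mem (f := LinearMap.snd K (Der L) M) hx'
    simp only [Submodule.map_iSup] at e1 e2
    refine Prod.ext (h1 ?_) (h2 ?_)
    · refine (iSup₂_mono fun j _ => ?_ : _ ≤ ⨆ j, ⨆ (_ : j ≠ i), (derLie L).gr j) e1
      rintro _ ⟨y, hy, rfl⟩
      exact hy.1
    · refine (iSup₂_mono fun j _ => ?_ : _ ≤ ⨆ j, ⨆ (_ : j ≠ i), G.gr j) e2
      rintro _ ⟨y, hy, rfl⟩
      exact hy.2
  · rw [eq_top_iff]
    rintro ⟨D, m⟩ -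
    have h1 : D ∈ ⨆ n, (derLie L).gr n := by
      rw [(derLie L).isInternal.submodule_iSup_eq_top]; trivial
    have h2 : m ∈ ⨆ n, G.gr n := by
      rw [G.isInternal.submodule_iSup_eq_top]; trivial
    have e1 := Submodule.mem_map_of_mem (f := LinearMap.inl K (Der L) M) h1
    have e2 := Submodule.mem_map_of_mem (f := LinearMap.inr K (Der L) M) h2
    rw [Submodule.map_iSup] at e1 e2
    have e : (D, m) = LinearMap.inl K (Der L) M D + LinearMap.inr K (Der L) M m := by simp
    rw [e]
    have k1 : ∀ n, ((derLie L).gr n).map (LinearMap.inl K (Der L) M) ≤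
        ((derLie L).gr n).prod (G.gr n) := by
      rintro n _ ⟨y, hy, rfl⟩
      exact ⟨hy, zero_mem _⟩
    have k2 : ∀ n, (G.gr n).map (LinearMap.inr K (Der L) M) ≤
        ((derLie L).gr n).prod (G.gr n) := by
      rintro n _ ⟨y, hy, rfl⟩
      exact ⟨zero_mem _, hy⟩
    exact add_mem (iSup_mono k1 e1) (iSup_mono k2 e2)

/-- The graded Lie algebra `Der(M/L) ⋉ M`. -/
noncomputable def semidirect : GradedLieAlgebra K (Der L × M) where
  gr n := ((derLie L).gr n).prod (G.gr n)
  isInternal := semidirect_isInternal L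
  bracket := semidirectBracket L
  bracket_mem := by
    rintro i j ⟨_, m⟩ ⟨_, n⟩ ⟨⟨D, rfl⟩, hm⟩ ⟨⟨E, rfl⟩, hn⟩
    refine ⟨(derLie L).bracket_mem ⟨D, rfl⟩ ⟨E, rfl⟩, ?_⟩
    have e := E.2.1 _ _ hm
    rw [add_comm j i] at e
    simp only [semidirectBracket, LinearMap.mk₂_apply]
    rw [twistedAct_lof L E hm]
    refine sub_mem (add_mem (G.bracket_mem hm hn) ?_) (Submodule.smul_mem _ _ e)
    simpa [toEnd] using D.2.1 _ _ hn
  skew := by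
    rintro i j ⟨_, m⟩ ⟨_, n⟩ ⟨⟨D, rfl⟩, hm⟩ ⟨⟨E, rfl⟩, hn⟩
    have hs : (-1 : K) ^ (i * j) * (-1 : K) ^ (i * j) = 1 := by rw [← mul_zpow]; simp
    refine Prod.ext ((derLie L).skew ⟨D, rfl⟩ ⟨E, rfl⟩) ?_
    simp only [semidirectBracket, LinearMap.mk₂_apply, Prod.snd_neg, Prod.smul_snd]
    rw [twistedAct_lof L E hm, twistedAct_lof L D hn, G.skew hm hn]
    simp only [toEnd, DirectSum.coeLinearMap_lof, mul_comm j i]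
    set a := (-1 : K) ^ (i * j)
    match_scalars <;> first | ring1 | linear_combination hs | linear_combination -hs
  jacobi := by
    rintro i j k ⟨_, m⟩ ⟨_, n⟩ ⟨_, l⟩ ⟨⟨D, rfl⟩, hm⟩ ⟨⟨E, rfl⟩, hn⟩ ⟨⟨F, rfl⟩, hl⟩
    have hs : (-1 : K) ^ (i * j) * (-1 : K) ^ (i * j) = 1 := by rw [← mul_zpow]; simp
    have h0 : (-1 : K) ≠ 0 := by simp
    refine Prod.ext ((derLie L).jacobi ⟨D, rfl⟩ ⟨E, rfl⟩ ⟨F, rfl⟩) ?_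
    replace hm : m ∈ G.gr i := hm
    replace hn : n ∈ G.gr j := hn
    replace hl : l ∈ G.gr k := hl
    have hmn := add_mem (G.bracket_mem hm hn) (D.2.1 _ _ hn)
    have hDE : (derLie L).bracket (DirectSum.lof K ℤ (fun n => derComp L n) i D)
        (DirectSum.lof K ℤ (fun n => derComp L n) j E) = _ := commBracket_lof _ _ D E
    have hDF : (derLie L).bracket (DirectSum.lof K ℤ (fun n => derComp L n) i D)
        (DirectSum.lof K ℤ (fun n => derComp L n) k F) = _ := commBracket_lof _ _ D F
    have hEF : (derLie L).bracket (DirectSum.lof K ℤ (fun n => derComp L n) j E)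
        (DirectSum.lof K ℤ (fun n => derComp L n) k F) = _ := commBracket_lof _ _ E F
    have hEm := E.2.1 _ _ hm
    rw [add_comm j i] at hEm
    simp only [semidirectBracket, LinearMap.mk₂_apply, Prod.snd_add, Prod.smul_snd, hDE, hDF, hEF,
      toEnd, DirectSum.coeLinearMap_lof]
    rw [twistedAct_lof L E hm, twistedAct_lof L F hm, twistedAct_lof L F hn,
      twistedAct_lof L _ hm, twistedAct_lof L _ hn,
      twistedAct_lof L F (sub_mem hmn (Submodule.smul_mem _ _ hEm))]
    simp only [commHom, LinearMap.mk₂_apply, map_add, map_sub,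
      map_smul, LinearMap.add_apply, LinearMap.sub_apply, LinearMap.smul_apply,
      Module.End.mul_apply, D.2.2.1 _ _ _ hn, E.2.2.1 _ _ _ hm, F.2.2.1 _ _ _ hm,
      G.jacobi hm hn hl, G.skew hn (F.2.1 _ _ hm), mul_add, add_mul, zpow_add₀ h0, mul_comm j i,
      mul_comm k i, mul_comm k j]
    set a := (-1 : K) ^ (i * j)
    set b := (-1 : K) ^ (i * k)
    set c := (-1 : K) ^ (j * k)
    have ht : b * b = 1 := by rw [← mul_zpow]; simp
    match_scalars <;> first | ring1 | grind

end Semidirect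

/-! ### Higher derived brackets -/

section Brackets

variable {K M : Type*} [Field K] [AddCommGroup M] [Module K M]

/-- The Koszul sign `ε(σ; a₁, …, a_n)` for `|a_j| = d j`, so that
`a₁ ⊙ ⋯ ⊙ a_n = ε(σ) a_{σ(1)} ⊙ ⋯ ⊙ a_{σ(n)}`. -/
def koszulSign (K : Type*) [Field K] {n : ℕ} (d : Fin n → ℤ) (σ : Equiv.Perm (Fin n)) : K :=
  ∏ i, ∏ j, if i < j ∧ σ j < σ i then (-1 : K) ^ (d (σ i) * d (σ j)) else 1

variable (G : GradedLieAlgebra K M)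

/-- `[⋯[[x, a₁], a₂]⋯, a_k]`. -/
def nest (x : M) (a : List M) : M := a.foldl (fun y b => G.bracket y b) x

/-- `[⋯[D a₁, a₂]⋯, a_k]` for `k ≥ 1`. -/
def nestDer (D : Module.End K M) : List M → M
  | [] => 0
  | b :: a => nest G (D b) a

/-- The value at `a₁ ⊙ ⋯ ⊙ a_n`, `|a_j| = d j`, of the higher derived bracket `Φ(m)_n`, where
`P` is the projection:
`∑_σ ε(σ) ∑_{0≤k≤n} B_{n-k}/(k!(n-k)!) [⋯[P[⋯[m, a_{σ(1)}]⋯, a_{σ(k)}], a_{σ(k+1)}]⋯, a_{σ(n)}]`.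
For `n = 0` it is `P m`. -/
noncomputable def bracketElem (P : Module.End K M) (m : M) {n : ℕ} (d : Fin n → ℤ)
    (a : Fin n → M) : M :=
  ∑ σ : Equiv.Perm (Fin n), koszulSign K d σ • ∑ k ∈ Finset.Icc 0 n,
    ((bernoulli (n - k) : K) / ((k.factorial : K) * ((n - k).factorial : K))) •
      nest G (P (nest G m ((List.ofFn fun j => a (σ j)).take k)))
        ((List.ofFn fun j => a (σ j)).drop k)

/-- The value at `a₁ ⊙ ⋯ ⊙ a_n`, `|a_j| = d j`, of the higher derived bracket `Φ(D)_n`: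
`∑_σ ε(σ) ∑_{1≤k≤n} B_{n-k}/(k!(n-k)!) [⋯[P[⋯[D a_{σ(1)}, a_{σ(2)}]⋯, a_{σ(k)}], ⋯]⋯, a_{σ(n)}]`.
For `n = 0` it is `0`. -/
noncomputable def bracketDer (P : Module.End K M) (D : Module.End K M) {n : ℕ} (d : Fin n → ℤ)
    (a : Fin n → M) : M :=
  ∑ σ : Equiv.Perm (Fin n), koszulSign K d σ • ∑ k ∈ Finset.Icc 1 n,
    ((bernoulli (n - k) : K) / ((k.factorial : K) * ((n - k).factorial : K))) •
      nest G (P (nestDer G D ((List.ofFn fun j => a (σ j)).take k)))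
        ((List.ofFn fun j => a (σ j)).drop k)

/-- `c` gives the Taylor coefficients of the coderivation `Q ∈ Coder(SA)`: for all `n` and all
homogeneous `a₁, …, a_n ∈ A` of degrees `d`, `p Q (a₁ ⊙ ⋯ ⊙ a_n) = c n d a`. -/
def HasTaylorCoeffs {G : GradedLieAlgebra K M} (A : GradedLieSubalgebra G) (Q : Coder A.gr)
    (c : ∀ n : ℕ, (Fin n → ℤ) → (Fin n → M) → M) : Prop :=
  ∀ (n : ℕ) (d : Fin n → ℤ) (a : Fin n → A.carrier), (∀ j, a j ∈ A.gr (d j)) →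
    (SymCoalg.proj A.gr (toEnd (coderComp A.gr) Q
      (List.ofFn fun j => SymCoalg.ι A.gr (a j)).prod) : M) =
      c n d fun j => a j

end Brackets

end HDB

/-!
Derivations are absorbed into elements: in the semidirect product `H = Der(M/L) ⋉ M` the space
`Der(M/L) ⋉ L` is a graded Lie subalgebra complementary to `A`, and `[(D, 0), (0, a)] = (0, D a)`,
so the brackets of `D` and `m` are the higher derived brackets of `(D, 0)` and `(0, m)` for this
decomposition of `H`. It suffices to attach coderivations to the elements of a graded Lie algebra
`H = V ⊕ ker pr` split into two graded Lie subalgebras (`Splitting`).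

Geometrically, `x ∈ H` acts on the formal homogeneous space with coordinates in `V` by a vector
field. Functions on it are linear maps `SV → H`, with the convolution bracket (`conv`, `gconv`); the
projection `SV → V ⊂ H` is the generic point, and `R` (`Splitting.adPt`) is the bracket with it, a
derivation of degree `0`, so that powers of `R` carry no Koszul signs. The vector field of `x` is
`φ(x) = b(R) P e^R x` with `b(t) = t / (e^t - 1)` (`Splitting.coeffs`), which is the generating
function of the higher derived brackets (`Splitting.inc_coeffs_ofFn_prod`). Identities between
maps out of `SV` are proved by induction on words, using `Δ(v c) = (v ⊗ 1 + 1 ⊗ v) Δ c`.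

Write `c(t) = (e^t - 1) / t`, `F_x = e^R x`, and let `Q_φ` be the coderivation with corestriction
`φ`. The derivative of `F_x` along `Q_φ` is `[F_x, c(R) φ]` (`Splitting.transport_comp_coder`),
which for `φ = φ(y)` is `[F_x, P F_y]` because `b c = 1`. On the other hand `P F_x = c(R) φ(x)`
satisfies the Maurer-Cartan equation (`Splitting.maurerCartan`). Comparing the two, and using that
`e^R` is an automorphism of the bracket and that both summands of `H` are subalgebras, shows that
the commutator of the coderivations of `x` and `y` has corestriction `φ([x, y])`
(`Splitting.coder_bracket`). In characteristic zero a coderivation is determined by its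
corestriction (`SymCoalg.coder_eq_zero`).
-/

open scoped DirectSum TensorProduct

namespace HDB

theorem neg_one_zpow_mul_self {K : Type*} [Field K] (n : ℤ) :
    (-1 : K) ^ n * (-1 : K) ^ n = 1 := by
  rw [← mul_zpow]
  simp

/-! ### Words in the symmetric coalgebra -/

section Coalgebra

variable {K V : Type*} [Field K] [AddCommGroup V] [Module K V]
variable (𝒱 : ℤ → Submodule K V)

namespace SymCoalg

/-- The product `v₁ ⊙ ⋯ ⊙ v_k` of a list of vectors tagged with degrees. -/
noncomputable def word (l : List (ℤ × V)) : SymCoalg 𝒱 :=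
  (l.map fun p => ι 𝒱 p.2).prod

/-- Each vector of the list is homogeneous of the degree it is tagged with. -/
def IsHomList (l : List (ℤ × V)) : Prop := ∀ p ∈ l, p.2 ∈ 𝒱 p.1

@[simp] theorem word_nil : word 𝒱 [] = 1 := rfl

@[simp] theorem word_cons (p : ℤ × V) (l : List (ℤ × V)) :
    word 𝒱 (p :: l) = ι 𝒱 p.2 * word 𝒱 l := by
  simp [word]

theorem isHomList_nil : IsHomList 𝒱 [] := by simp [IsHomList]

variable {𝒱} in
theorem IsHomList.head {p : ℤ × V} {l : List (ℤ × V)} (h : IsHomList 𝒱 (p :: l)) :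
    p.2 ∈ 𝒱 p.1 := h p (by simp)

variable {𝒱} in
theorem IsHomList.tail {p : ℤ × V} {l : List (ℤ × V)} (h : IsHomList 𝒱 (p :: l)) :
    IsHomList 𝒱 l := fun q hq => h q (by simp [hq])

theorem word_mem_gr {l : List (ℤ × V)} (h : IsHomList 𝒱 l) :
    word 𝒱 l ∈ gr 𝒱 (l.map Prod.fst).sum :=
  Submodule.subset_span ⟨l, h, rfl, rfl⟩

/-- The algebra map `SV → K ⊕ V` onto the parts of length `0` and `1`. -/
noncomputable def toTriv :
    letI : Module Kᵐᵒᵖ V := Module.compHom _ ((RingHom.id K).fromOpposite mul_comm)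
    haveI : IsCentralScalar K V := ⟨fun _ _ => rfl⟩
    SymCoalg 𝒱 →ₐ[K] TrivSqZeroExt K V :=
  letI : Module Kᵐᵒᵖ V := Module.compHom _ ((RingHom.id K).fromOpposite mul_comm)
  haveI : IsCentralScalar K V := ⟨fun _ _ => rfl⟩
  lift 𝒱 (B := TrivSqZeroExt K V) (TrivSqZeroExt.inrHom K V) (by simp)

/-- The counit `ε : SV → K`. -/
noncomputable def counit : SymCoalg 𝒱 →ₐ[K] K :=
  letI : Module Kᵐᵒᵖ V := Module.compHom _ ((RingHom.id K).fromOpposite mul_comm)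
  haveI : IsCentralScalar K V := ⟨fun _ _ => rfl⟩
  (TrivSqZeroExt.fstHom K K V).comp (toTriv 𝒱)

@[simp] theorem counit_ι (v : V) : counit 𝒱 (ι 𝒱 v) = 0 := by
  simp [counit, toTriv, lift_ι]

theorem proj_one : proj 𝒱 1 = 0 := by
  let _ : Module Kᵐᵒᵖ V := Module.compHom _ ((RingHom.id K).fromOpposite mul_comm)
  have _ : IsCentralScalar K V := ⟨fun _ _ => rfl⟩
  exact congrArg TrivSqZeroExt.snd (map_one (toTriv 𝒱))

theorem proj_ι_mul (v : V) (c : SymCoalg 𝒱) :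
    proj 𝒱 (ι 𝒱 v * c) = counit 𝒱 c • v := by
  simp [proj, counit, toTriv, lift_ι]
  rfl

variable [DirectSum.Decomposition 𝒱]

theorem span_words : Submodule.span K {x | ∃ l, IsHomList 𝒱 l ∧ word 𝒱 l = x} = ⊤ := by
  rw [eq_top_iff, ← (DirectSum.Decomposition.isInternal (gr 𝒱)).submodule_iSup_eq_top, iSup_le_iff]
  intro n
  refine Submodule.span_mono ?_
  rintro x ⟨l, h, -, rfl⟩
  exact ⟨l, h, rfl⟩

variable {𝒱} in
theorem word_induction {P : SymCoalg 𝒱 → Prop} (c : SymCoalg 𝒱)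
    (word : ∀ l, IsHomList 𝒱 l → P (word 𝒱 l)) (zero : P 0)
    (add : ∀ x y, P x → P y → P (x + y)) (smul : ∀ (r : K) x, P x → P (r • x)) : P c := by
  have h : c ∈ Submodule.span K {x | ∃ l, IsHomList 𝒱 l ∧ SymCoalg.word 𝒱 l = x} := by
    rw [span_words]; trivial
  induction h using Submodule.span_induction with
  | mem x hx => obtain ⟨l, h, rfl⟩ := hx; exact word l h
  | zero => exact zero
  | add x y _ _ hx hy => exact add x y hx hy
  | smul r x _ hx => exact smul r x hx

variable {𝒱} in
/-- Induction on the length of words: the workhorse for all identities between maps out of `SV`. -/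
theorem induction_on {P : SymCoalg 𝒱 → Prop} (c : SymCoalg 𝒱) (one : P 1)
    (ι_mul : ∀ i, ∀ v ∈ 𝒱 i, ∀ c, P c → P (ι 𝒱 v * c)) (zero : P 0)
    (add : ∀ x y, P x → P y → P (x + y)) (smul : ∀ (r : K) x, P x → P (r • x)) : P c := by
  refine word_induction c (fun l hl => ?_) zero add smul
  induction l with
  | nil => exact one
  | cons p l ih =>
    rw [word_cons]
    exact ι_mul p.1 p.2 hl.head _ (ih hl.tail)

variable {𝒱} in
theorem linearMap_ext_word {Z : Type*} [AddCommGroup Z] [Module K Z] {f g : SymCoalg 𝒱 →ₗ[K] Z}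
    (h : ∀ l, IsHomList 𝒱 l → f (word 𝒱 l) = g (word 𝒱 l)) : f = g := by
  ext c
  induction c using word_induction (𝒱 := 𝒱) with
  | word l hl => exact h l hl
  | zero => simp
  | add x y hx hy => simp only [map_add, hx, hy]
  | smul r x hx => simp only [map_smul, hx]

variable {𝒱} in
theorem linearMap_ext_gr {Z : Type*} [AddCommGroup Z] [Module K Z] {f g : SymCoalg 𝒱 →ₗ[K] Z}
    (h : ∀ i, ∀ x ∈ gr 𝒱 i, f x = g x) : f = g :=
  linearMap_ext_word fun _ hl => h _ _ (word_mem_gr 𝒱 hl)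

/-- The operator `c ↦ (-1)^(n |c|) c` on `SV`. -/
noncomputable abbrev tw (n : ℤ) : SymCoalg 𝒱 →ₗ[K] SymCoalg 𝒱 := twist (gr 𝒱) n

/-- Left multiplication by a vector. -/
noncomputable abbrev mulι (v : V) : SymCoalg 𝒱 →ₗ[K] SymCoalg 𝒱 :=
  LinearMap.mulLeft K (ι 𝒱 v)

@[simp] theorem tw_one (n : ℤ) : tw 𝒱 n 1 = 1 := by
  rw [tw, twist_of_mem _ n (SetLike.GradedOne.one_mem : (1 : SymCoalg 𝒱) ∈ gr 𝒱 0)]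
  simp

@[simp] theorem tw_zero : tw 𝒱 0 = LinearMap.id := by
  refine linearMap_ext_gr fun i x hx => ?_
  simp [tw, twist_of_mem _ 0 hx]

theorem tw_comp_tw (p q : ℤ) : tw 𝒱 p ∘ₗ tw 𝒱 q = tw 𝒱 (p + q) := twist_comp_twist _ p q

@[simp] theorem tw_tw (p q : ℤ) (c : SymCoalg 𝒱) : tw 𝒱 p (tw 𝒱 q c) = tw 𝒱 (p + q) c :=
  LinearMap.congr_fun (tw_comp_tw 𝒱 p q) c

theorem tw_comp_mulι (n : ℤ) {i : ℤ} {v : V} (hv : v ∈ 𝒱 i) :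
    tw 𝒱 n ∘ₗ mulι 𝒱 v = (-1 : K) ^ (n * i) • (mulι 𝒱 v ∘ₗ tw 𝒱 n) :=
  twist_comp_of_degree _ n i _ fun _ _ hx => SetLike.GradedMul.mul_mem (ι_mem 𝒱 hv) hx

theorem tw_ι_mul (n : ℤ) {i : ℤ} {v : V} (hv : v ∈ 𝒱 i) (c : SymCoalg 𝒱) :
    tw 𝒱 n (ι 𝒱 v * c) = (-1 : K) ^ (n * i) • (ι 𝒱 v * tw 𝒱 n c) :=
  LinearMap.congr_fun (tw_comp_mulι 𝒱 n hv) c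

@[simp] theorem counit_tw (n : ℤ) (c : SymCoalg 𝒱) : counit 𝒱 (tw 𝒱 n c) = counit 𝒱 c := by
  induction c using induction_on (𝒱 := 𝒱) with
  | one => simp
  | ι_mul i v hv c _ => rw [tw_ι_mul 𝒱 n hv]; simp
  | zero => simp
  | add x y hx hy => simp only [map_add, hx, hy]
  | smul r x hx => simp only [map_smul, hx]

/-! ### The comultiplication on words -/

@[simp] theorem comul_one : comul 𝒱 1 = 1 ⊗ₜ[K] 1 := by
  simp [comul]
  rfl

/-- Multiplying by a unit `±1` of `ℤ` raised to an integer is scaling by the same sign in `K`. -/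
theorem units_neg_one_zpow_smul {Z : Type*} [AddCommGroup Z] [Module K Z] (n : ℤ) (z : Z) :
    ((-1 : ℤˣ) ^ n) • z = (-1 : K) ^ n • z := by
  rcases Int.even_or_odd n with hn | hn
  · rw [hn.neg_one_zpow, hn.neg_one_zpow, one_smul, one_smul]
  · rw [hn.neg_one_zpow, hn.neg_one_zpow, neg_smul, one_smul, Units.neg_smul, one_smul]

/-- `Δ(v c) = (v ⊗ 1 + 1 ⊗ v) Δ c`, with the Koszul sign of moving `v` past the left factor. -/
theorem comul_ι_mul {i : ℤ} {v : V} (hv : v ∈ 𝒱 i) (c : SymCoalg 𝒱) :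
    comul 𝒱 (ι 𝒱 v * c) =
      (TensorProduct.map (mulι 𝒱 v) LinearMap.id + TensorProduct.map (tw 𝒱 i) (mulι 𝒱 v) :
        SymCoalg 𝒱 ⊗[K] SymCoalg 𝒱 →ₗ[K] SymCoalg 𝒱 ⊗[K] SymCoalg 𝒱) (comul 𝒱 c) := by
  have h1 : comul 𝒱 (ι 𝒱 v * c) = (GradedTensorProduct.of K (gr 𝒱) (gr 𝒱)).symm
      ((GradedTensorProduct.includeLeft (gr 𝒱) (gr 𝒱) (ι 𝒱 v) +
        GradedTensorProduct.includeRight (gr 𝒱) (gr 𝒱) (ι 𝒱 v)) *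
        GradedTensorProduct.of K (gr 𝒱) (gr 𝒱) (comul 𝒱 c)) := by
    simp [comul, comulAlgHom, lift_ι]
  rw [h1]
  generalize comul 𝒱 c = z
  induction z using TensorProduct.induction_on with
  | zero => simp
  | add x y hx hy => simp only [map_add, mul_add, hx, hy]
  | tmul x y =>
    induction x using DirectSum.Decomposition.inductionOn (gr 𝒱) with
    | zero => simp
    | add x x' hx hx' => simp only [TensorProduct.add_tmul, map_add, mul_add, hx, hx']
    | @homogeneous j x =>
      have e1 := GradedTensorProduct.tmul_coe_mul_coe_tmul (R := K) (gr 𝒱) (gr 𝒱) (ι 𝒱 v)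
        (1 : gr 𝒱 0) x y
      have e2 := GradedTensorProduct.tmul_coe_mul_coe_tmul (R := K) (gr 𝒱) (gr 𝒱) 1
        ⟨ι 𝒱 v, ι_mem 𝒱 hv⟩ x y
      rw [units_neg_one_zpow_smul (K := K)] at e1 e2
      rw [add_mul, map_add, LinearMap.add_apply]
      congr 1
      · refine (congrArg _ e1).trans ?_
        simp
      · refine (congrArg _ e2).trans ?_
        simp only [one_mul, map_smul, TensorProduct.map_tmul, tw, twist_of_mem _ i x.2,
          LinearMap.mulLeft_apply]
        rfl

/-! ### Convolution -/

variable {Z Z' : Type*} [AddCommGroup Z] [Module K Z] [AddCommGroup Z'] [Module K Z']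

/-- The map `c ↦ ∑ b(c₍₁₎, c₍₂₎)`, for a bilinear map `b`. -/
noncomputable def cv : (SymCoalg 𝒱 →ₗ[K] SymCoalg 𝒱 →ₗ[K] Z) →ₗ[K] SymCoalg 𝒱 →ₗ[K] Z :=
  LinearMap.lcomp K Z (comul 𝒱) ∘ₗ
    (TensorProduct.lift.equiv (.id K) (SymCoalg 𝒱) (SymCoalg 𝒱) Z).toLinearMap

theorem cv_apply (b : SymCoalg 𝒱 →ₗ[K] SymCoalg 𝒱 →ₗ[K] Z) (c : SymCoalg 𝒱) :
    cv 𝒱 b c = TensorProduct.lift b (comul 𝒱 c) := rfl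

@[simp] theorem cv_one (b : SymCoalg 𝒱 →ₗ[K] SymCoalg 𝒱 →ₗ[K] Z) : cv 𝒱 b 1 = b 1 1 := by
  simp [cv_apply]

theorem smul_cv (r : K) (b : SymCoalg 𝒱 →ₗ[K] SymCoalg 𝒱 →ₗ[K] Z) (c : SymCoalg 𝒱) :
    r • cv 𝒱 b c = cv 𝒱 (r • b) c := by
  simp

/-- The recursion that reduces identities for convolutions to shorter words. -/
theorem cv_ι_mul (b : SymCoalg 𝒱 →ₗ[K] SymCoalg 𝒱 →ₗ[K] Z) {i : ℤ} {v : V} (hv : v ∈ 𝒱 i)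
    (c : SymCoalg 𝒱) :
    cv 𝒱 b (ι 𝒱 v * c) =
      cv 𝒱 (b ∘ₗ mulι 𝒱 v) c + cv 𝒱 (b.compl₁₂ (tw 𝒱 i) (mulι 𝒱 v)) c := by
  simp only [cv_apply, comul_ι_mul 𝒱 hv, LinearMap.add_apply, map_add]
  congr 1 <;>
  · rw [← LinearMap.comp_apply]
    congr 1
    ext x y
    simp

theorem map_cv (h : Z →ₗ[K] Z') (b : SymCoalg 𝒱 →ₗ[K] SymCoalg 𝒱 →ₗ[K] Z) (c : SymCoalg 𝒱) :
    h (cv 𝒱 b c) = cv 𝒱 (b.compr₂ h) c := by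
  simp only [cv_apply]
  rw [← LinearMap.comp_apply]
  congr 1
  ext x y
  simp

/-- `Δ` commutes with the sign operators. -/
theorem cv_tw (n : ℤ) (b : SymCoalg 𝒱 →ₗ[K] SymCoalg 𝒱 →ₗ[K] Z) (c : SymCoalg 𝒱) :
    cv 𝒱 b (tw 𝒱 n c) = cv 𝒱 (b.compl₁₂ (tw 𝒱 n) (tw 𝒱 n)) c := by
  induction c using induction_on (𝒱 := 𝒱) generalizing b with
  | one => simp
  | zero => simp
  | add x y hx hy => simp only [map_add, hx, hy]
  | smul r x hx => simp only [map_smul, hx]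
  | ι_mul i v hv c ih =>
    rw [tw_ι_mul 𝒱 n hv, map_smul, cv_ι_mul 𝒱 b hv, cv_ι_mul 𝒱 _ hv, ih, ih, smul_add,
      smul_cv, smul_cv]
    congr 3
    · ext x y
      simp [tw_ι_mul 𝒱 n hv]
    · ext x y
      simp [tw_ι_mul 𝒱 n hv, add_comm]

/-- The counit is a right unit for the comultiplication. -/
theorem cv_counit_right (h : SymCoalg 𝒱 →ₗ[K] Z) (c : SymCoalg 𝒱) :
    cv 𝒱 ((LinearMap.lsmul K Z).flip.compl₁₂ h (counit 𝒱).toLinearMap) c = h c := by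
  induction c using induction_on (𝒱 := 𝒱) generalizing h with
  | one => simp
  | zero => simp
  | add x y hx hy => simp only [map_add, hx, hy]
  | smul r x hx => simp only [map_smul, hx]
  | ι_mul i v hv c ih =>
    rw [cv_ι_mul 𝒱 _ hv]
    have e1 : (LinearMap.lsmul K Z).flip.compl₁₂ h (counit 𝒱).toLinearMap ∘ₗ mulι 𝒱 v =
        (LinearMap.lsmul K Z).flip.compl₁₂ (h ∘ₗ mulι 𝒱 v) (counit 𝒱).toLinearMap := by
      ext x y; simp
    have e2 : ((LinearMap.lsmul K Z).flip.compl₁₂ h (counit 𝒱).toLinearMap).compl₁₂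
        (tw 𝒱 i) (mulι 𝒱 v) = 0 := by
      ext x y; simp
    rw [e1, e2, ih]
    simp

/-- The counit is a left unit for the comultiplication. -/
theorem cv_counit_left (h : SymCoalg 𝒱 →ₗ[K] Z) (c : SymCoalg 𝒱) :
    cv 𝒱 ((LinearMap.lsmul K Z).compl₁₂ (counit 𝒱).toLinearMap h) c = h c := by
  induction c using induction_on (𝒱 := 𝒱) generalizing h with
  | one => simp
  | zero => simp
  | add x y hx hy => simp only [map_add, hx, hy]
  | smul r x hx => simp only [map_smul, hx]
  | ι_mul i v hv c ih =>
    rw [cv_ι_mul 𝒱 _ hv]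
    have e1 : (LinearMap.lsmul K Z).compl₁₂ (counit 𝒱).toLinearMap h ∘ₗ mulι 𝒱 v = 0 := by
      ext x y; simp
    have e2 : ((LinearMap.lsmul K Z).compl₁₂ (counit 𝒱).toLinearMap h).compl₁₂
        (tw 𝒱 i) (mulι 𝒱 v) =
        (LinearMap.lsmul K Z).compl₁₂ (counit 𝒱).toLinearMap (h ∘ₗ mulι 𝒱 v) := by
      ext x y; simp
    rw [e1, e2, ih]
    simp

end SymCoalg

end Coalgebra

/-! ### Coderivations and their Taylor coefficients -/

section Coderivations

variable {K V : Type*} [Field K] [AddCommGroup V] [Module K V]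
variable (𝒱 : ℤ → Submodule K V)
variable {Z : Type*} [AddCommGroup Z] [Module K Z]

namespace SymCoalg

variable {𝒱} in
theorem mem_of_forall_word {f : SymCoalg 𝒱 →ₗ[K] Z} {S : Submodule K Z} {i : ℤ}
    (h : ∀ l, IsHomList 𝒱 l → (l.map Prod.fst).sum = i → f (word 𝒱 l) ∈ S)
    {x : SymCoalg 𝒱} (hx : x ∈ gr 𝒱 i) : f x ∈ S := by
  have h' : gr 𝒱 i ≤ S.comap f := by
    refine Submodule.span_le.2 ?_
    rintro _ ⟨l, hl, hi, rfl⟩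
    exact h l hl hi
  exact h' hx

/-- A map out of `SV` is homogeneous of degree `q` with respect to a grading of the target. -/
def IsHomOfDeg (𝒵 : ℤ → Submodule K Z) (q : ℤ) (f : SymCoalg 𝒱 →ₗ[K] Z) : Prop :=
  ∀ (i : ℤ) (x : SymCoalg 𝒱), x ∈ gr 𝒱 i → f x ∈ 𝒵 (q + i)

variable {𝒱} in
theorem IsHomOfDeg.comp_mulι {𝒵 : ℤ → Submodule K Z} {q : ℤ} {f : SymCoalg 𝒱 →ₗ[K] Z}
    (hf : IsHomOfDeg 𝒱 𝒵 q f) {i : ℤ} {v : V} (hv : v ∈ 𝒱 i) :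
    IsHomOfDeg 𝒱 𝒵 (q + i) (f ∘ₗ mulι 𝒱 v) := fun j x hx => by
  rw [add_assoc]
  exact hf _ _ (SetLike.GradedMul.mul_mem (ι_mem 𝒱 hv) hx)

theorem proj_isHomOfDeg : IsHomOfDeg 𝒱 𝒱 0 (proj 𝒱) := by
  intro i x hx
  rw [zero_add]
  refine mem_of_forall_word (fun l hl hi => ?_) hx
  match l, hl, hi with
  | [], _, _ => simp [proj_one]
  | [p], hl, hi =>
    have : p.1 = i := by simpa using hi
    rw [word_cons, proj_ι_mul, ← this]
    exact Submodule.smul_mem _ _ hl.head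
  | p :: p' :: l, _, _ => simp [proj_ι_mul]

variable [DirectSum.Decomposition 𝒱]

theorem tw_word (n : ℤ) {l : List (ℤ × V)} (hl : IsHomList 𝒱 l) :
    tw 𝒱 n (word 𝒱 l) = (-1 : K) ^ (n * (l.map Prod.fst).sum) • word 𝒱 l :=
  twist_of_mem _ n (word_mem_gr 𝒱 hl)

variable {𝒱} in
/-- `Δ` preserves the length of words: `Δ (v₁ ⋯ v_n)` only involves words of lengths `p + q = n`. -/
theorem cv_word_eq_zero {l : List (ℤ × V)} (hl : IsHomList 𝒱 l)
    {b : SymCoalg 𝒱 →ₗ[K] SymCoalg 𝒱 →ₗ[K] Z}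
    (hb : ∀ l₁ l₂, IsHomList 𝒱 l₁ → IsHomList 𝒱 l₂ → l₁.length + l₂.length = l.length →
      b (word 𝒱 l₁) (word 𝒱 l₂) = 0) : cv 𝒱 b (word 𝒱 l) = 0 := by
  induction l generalizing b with
  | nil => simpa using hb [] [] (isHomList_nil 𝒱) (isHomList_nil 𝒱) rfl
  | cons p l ih =>
    have hc : ∀ l', IsHomList 𝒱 l' → IsHomList 𝒱 (p :: l') := fun l' h' q hq => by
      rcases List.mem_cons.1 hq with rfl | hq
      exacts [hl.head, h' q hq]
    rw [word_cons, cv_ι_mul 𝒱 b hl.head, ih hl.tail, ih hl.tail, add_zero]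
    · intro l₁ l₂ h₁ h₂ h
      have := hb l₁ (p :: l₂) h₁ (hc l₂ h₂) (by simp only [List.length_cons]; omega)
      rw [word_cons] at this
      simp [tw_word 𝒱 _ h₁, this]
    · intro l₁ l₂ h₁ h₂ h
      have := hb (p :: l₁) l₂ (hc l₁ h₁) h₂ (by simp only [List.length_cons]; omega)
      rw [word_cons] at this
      simpa using this

variable {𝒱} in
theorem IsHomOfDeg.comp_tw {𝒵 : ℤ → Submodule K Z} {q : ℤ} {f : SymCoalg 𝒱 →ₗ[K] Z}
    (hf : IsHomOfDeg 𝒱 𝒵 q f) (n : ℤ) : IsHomOfDeg 𝒱 𝒵 q (f ∘ₗ tw 𝒱 n) := fun j x hx => by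
  rw [LinearMap.comp_apply, tw, twist_of_mem _ n hx, map_smul]
  exact Submodule.smul_mem _ _ (hf j x hx)

/-- The map `Q_φ : c ↦ ∑ φ(c₍₁₎) ⊙ c₍₂₎`, the coderivation with corestriction `φ : SV → V`. -/
noncomputable def coderOf : (SymCoalg 𝒱 →ₗ[K] V) →ₗ[K] Module.End K (SymCoalg 𝒱) :=
  cv 𝒱 ∘ₗ (LinearMap.lcomp K _ (.id (M := SymCoalg 𝒱)) ∘ₗ
    (LinearMap.mul K (SymCoalg 𝒱)) ∘ₗ ι 𝒱).compRight K

theorem coderOf_apply (φ : SymCoalg 𝒱 →ₗ[K] V) (c : SymCoalg 𝒱) :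
    coderOf 𝒱 φ c =
      cv 𝒱 ((LinearMap.mul K (SymCoalg 𝒱)).compl₁₂ (ι 𝒱 ∘ₗ φ) LinearMap.id) c := rfl

@[simp] theorem coderOf_one (φ : SymCoalg 𝒱 →ₗ[K] V) : coderOf 𝒱 φ 1 = ι 𝒱 (φ 1) := by
  simp [coderOf_apply]

/-- The recursion that determines `Q_φ` from the restrictions of `φ` to products with a vector. -/
theorem coderOf_ι_mul {q : ℤ} {φ : SymCoalg 𝒱 →ₗ[K] V} (hφ : IsHomOfDeg 𝒱 𝒱 q φ)
    {i : ℤ} {v : V} (hv : v ∈ 𝒱 i) (c : SymCoalg 𝒱) :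
    coderOf 𝒱 φ (ι 𝒱 v * c) =
      coderOf 𝒱 (φ ∘ₗ mulι 𝒱 v) c + (-1 : K) ^ (i * q) • (ι 𝒱 v * coderOf 𝒱 φ c) := by
  rw [coderOf_apply, cv_ι_mul 𝒱 _ hv]
  congr 1
  rw [coderOf_apply, ← LinearMap.mulLeft_apply (R := K) (ι 𝒱 v), map_cv, smul_cv]
  congr 2
  refine linearMap_ext_gr fun j x hx => ?_
  ext y
  have h := ι_mul_ι 𝒱 (hφ j x hx) hv
  simp [tw, twist_of_mem _ i hx, ← mul_assoc, h, smul_smul, mul_comm (q + j) i, mul_add,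
    zpow_add₀ (show (-1 : K) ≠ 0 by simp)]
  congr 1
  linear_combination (-1 : K) ^ (i * q) * neg_one_zpow_mul_self (K := K) (i * j)

theorem coderOf_mem_gr {q : ℤ} {φ : SymCoalg 𝒱 →ₗ[K] V} (hφ : IsHomOfDeg 𝒱 𝒱 q φ) :
    IsHomOfDeg 𝒱 (gr 𝒱) q (coderOf 𝒱 φ) := by
  have key : ∀ l, IsHomList 𝒱 l → ∀ (q : ℤ) (φ : SymCoalg 𝒱 →ₗ[K] V), IsHomOfDeg 𝒱 𝒱 q φ →
      coderOf 𝒱 φ (word 𝒱 l) ∈ gr 𝒱 (q + (l.map Prod.fst).sum) := by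
    intro l hl
    induction l with
    | nil =>
      intro q φ hφ
      rw [word_nil, coderOf_one]
      exact ι_mem 𝒱 (hφ 0 1 SetLike.GradedOne.one_mem)
    | cons p l ih =>
      intro q φ hφ
      rw [word_cons, coderOf_ι_mul 𝒱 hφ hl.head, List.map_cons, List.sum_cons, ← add_assoc]
      refine add_mem (ih hl.tail _ _ (hφ.comp_mulι hl.head)) (Submodule.smul_mem _ _ ?_)
      rw [add_comm q, add_assoc]
      exact SetLike.GradedMul.mul_mem (ι_mem 𝒱 hl.head) (ih hl.tail _ _ hφ)
  intro i x hx
  refine mem_of_forall_word (fun l hl hi => ?_) hx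
  subst hi
  exact key l hl q φ hφ

theorem coderOf_mem_coderComp {q : ℤ} {φ : SymCoalg 𝒱 →ₗ[K] V} (hφ : IsHomOfDeg 𝒱 𝒱 q φ) :
    coderOf 𝒱 φ ∈ coderComp 𝒱 q := by
  refine ⟨coderOf_mem_gr 𝒱 hφ, ?_⟩
  ext c
  simp only [LinearMap.comp_apply]
  induction c using induction_on (𝒱 := 𝒱) generalizing φ q with
  | one =>
    have h := comul_ι_mul 𝒱 (hφ 0 1 SetLike.GradedOne.one_mem) 1
    rw [mul_one] at h
    simp [h, tw]
  | zero => simp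
  | add x y hx hy => simp only [map_add, hx hφ, hy hφ]
  | smul r x hx => simp only [map_smul, hx hφ]
  | ι_mul i v hv c ih =>
    have e1 : coderOf 𝒱 φ ∘ₗ mulι 𝒱 v =
        coderOf 𝒱 (φ ∘ₗ mulι 𝒱 v) + (-1 : K) ^ (i * q) • (mulι 𝒱 v ∘ₗ coderOf 𝒱 φ) := by
      ext c; exact coderOf_ι_mul 𝒱 hφ hv c
    have e2 := twist_comp_of_degree (gr 𝒱) i q _ (coderOf_mem_gr 𝒱 hφ)
    have e3 := tw_comp_mulι 𝒱 q hv
    have hs := neg_one_zpow_mul_self (K := K) (i * q)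
    rw [coderOf_ι_mul 𝒱 hφ hv, map_add, map_smul, comul_ι_mul 𝒱 hv, comul_ι_mul 𝒱 hv, ih hφ,
      ih (hφ.comp_mulι hv)]
    generalize comul 𝒱 c = z
    simp only [← LinearMap.comp_apply, ← LinearMap.smul_apply, ← LinearMap.add_apply]
    congr 1
    simp only [LinearMap.add_comp, LinearMap.comp_add, ← TensorProduct.map_comp,
      LinearMap.id_comp, LinearMap.comp_id, e1, e2, e3, TensorProduct.map_add_left,
      TensorProduct.map_add_right, TensorProduct.map_smul_left, TensorProduct.map_smul_right,
      smul_add, smul_smul, mul_comm q i, add_comm q i, hs, one_smul, twist_comp_twist]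
    abel

theorem proj_coderOf (φ : SymCoalg 𝒱 →ₗ[K] V) (c : SymCoalg 𝒱) :
    proj 𝒱 (coderOf 𝒱 φ c) = φ c := by
  rw [coderOf_apply, map_cv]
  refine Eq.trans ?_ (cv_counit_right 𝒱 φ c)
  congr 2
  ext x y
  simp [proj_ι_mul]

variable {𝒱} in
/-- The coderivation property in terms of `cv`: coderivations obey the Leibniz rule for every
convolution of maps out of `SV`. -/
theorem cv_coder {q : ℤ} {Q : Module.End K (SymCoalg 𝒱)} (hQ : Q ∈ coderComp 𝒱 q)
    (b : SymCoalg 𝒱 →ₗ[K] SymCoalg 𝒱 →ₗ[K] Z) (c : SymCoalg 𝒱) :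
    cv 𝒱 b (Q c) = cv 𝒱 (b ∘ₗ Q) c + cv 𝒱 (b.compl₁₂ (tw 𝒱 q) Q) c := by
  have h := LinearMap.congr_fun hQ.2 c
  rw [LinearMap.comp_apply, LinearMap.comp_apply] at h
  simp only [cv_apply, h, LinearMap.add_apply, map_add]
  congr 1 <;>
  · rw [← LinearMap.comp_apply]
    congr 1
    refine TensorProduct.ext' fun x y => ?_
    simp

variable {𝒱} in
theorem counit_coder {q : ℤ} {Q : Module.End K (SymCoalg 𝒱)} (hQ : Q ∈ coderComp 𝒱 q)
    (c : SymCoalg 𝒱) : counit 𝒱 (Q c) = 0 := by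
  have h := cv_counit_left 𝒱 (counit 𝒱).toLinearMap (Q c)
  have h2 := cv_counit_right 𝒱 ((counit 𝒱).toLinearMap ∘ₗ Q) c
  have h3 := cv_counit_left 𝒱 ((counit 𝒱).toLinearMap ∘ₗ Q) c
  rw [cv_coder hQ] at h
  rw [show ((LinearMap.lsmul K K).compl₁₂ (counit 𝒱).toLinearMap (counit 𝒱).toLinearMap) ∘ₗ Q =
    (LinearMap.lsmul K K).flip.compl₁₂ ((counit 𝒱).toLinearMap ∘ₗ Q) (counit 𝒱).toLinearMap by
      ext x y; simp [mul_comm], h2,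
    show ((LinearMap.lsmul K K).compl₁₂ (counit 𝒱).toLinearMap (counit 𝒱).toLinearMap).compl₁₂
      (tw 𝒱 q) Q =
    (LinearMap.lsmul K K).compl₁₂ (counit 𝒱).toLinearMap ((counit 𝒱).toLinearMap ∘ₗ Q) by
      ext x y; simp, h3] at h
  simpa using h

/-- The coderivation `Q_p` is the Euler operator: it multiplies a word by its length. -/
theorem coderOf_proj_word {l : List (ℤ × V)} (hl : IsHomList 𝒱 l) :
    coderOf 𝒱 (proj 𝒱) (word 𝒱 l) = (l.length : K) • word 𝒱 l := by
  induction l with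
  | nil => simp [proj_one]
  | cons p l ih =>
    have e : coderOf 𝒱 (proj 𝒱 ∘ₗ mulι 𝒱 p.2) (word 𝒱 l) = ι 𝒱 p.2 * word 𝒱 l := by
      rw [coderOf_apply]
      refine Eq.trans ?_ (cv_counit_left 𝒱 (mulι 𝒱 p.2) (word 𝒱 l))
      congr 2
      ext x y
      simp [proj_ι_mul]
    rw [word_cons, coderOf_ι_mul 𝒱 (proj_isHomOfDeg 𝒱) hl.head, e, ih hl.tail]
    simp [add_smul, add_comm]

variable {𝒱} in
/-- The kernel of the Euler operator consists of the scalars, since `SV` is the sum of its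
eigenspaces and the words of positive length have nonzero eigenvalues. -/
theorem eq_zero_of_coderOf_proj_eq_zero [CharZero K] {x : SymCoalg 𝒱}
    (hx : coderOf 𝒱 (proj 𝒱) x = 0) (hε : counit 𝒱 x = 0) : x = 0 := by
  have key : ∀ c : SymCoalg 𝒱, c - counit 𝒱 c • 1 ∈
      ⨆ r : K, ⨆ (_ : r ≠ 0), Module.End.eigenspace (coderOf 𝒱 (proj 𝒱)) r := by
    intro c
    induction c using word_induction (𝒱 := 𝒱) with
    | zero => simp
    | add x y hx hy =>
      rw [map_add, add_smul, add_sub_add_comm]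
      exact add_mem hx hy
    | smul r x hx =>
      rw [map_smul, smul_assoc, ← smul_sub]
      exact Submodule.smul_mem _ _ hx
    | word l hl =>
      cases l with
      | nil => simp
      | cons p l =>
        have h0 : counit 𝒱 (word 𝒱 (p :: l)) = 0 := by simp
        rw [h0, zero_smul, sub_zero]
        refine Submodule.mem_iSup_of_mem (((p :: l).length : ℕ) : K)
          (Submodule.mem_iSup_of_mem (by
            simp only [List.length_cons]
            exact Nat.cast_ne_zero.2 (by omega)) ?_)
        rw [Module.End.mem_eigenspace_iff]
        exact coderOf_proj_word 𝒱 hl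
  have h := key x
  rw [hε, zero_smul, sub_zero] at h
  refine Submodule.disjoint_def.1
    (Module.End.eigenspaces_iSupIndep (coderOf 𝒱 (proj 𝒱)) 0) x ?_ h
  rw [Module.End.mem_eigenspace_iff, hx, zero_smul]

variable {𝒱} in
/-- A coderivation is determined by its corestriction. If `Q` kills all shorter words and
`p Q = 0`, then multiplying `Q w` by the length operator gives `0`. -/
theorem coder_eq_zero [CharZero K] {q : ℤ} {Q : Module.End K (SymCoalg 𝒱)}
    (hQ : Q ∈ coderComp 𝒱 q) (hp : ∀ c, proj 𝒱 (Q c) = 0) : Q = 0 := by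
  have key : ∀ n : ℕ, ∀ l, IsHomList 𝒱 l → l.length = n → Q (word 𝒱 l) = 0 := by
    intro n
    induction n using Nat.strong_induction_on with
    | _ n ih =>
      intro l hl hn
      refine eq_zero_of_coderOf_proj_eq_zero ?_ (counit_coder hQ _)
      rw [coderOf_apply, cv_coder hQ]
      have e : ((LinearMap.mul K (SymCoalg 𝒱)).compl₁₂ (ι 𝒱 ∘ₗ proj 𝒱) LinearMap.id) ∘ₗ Q = 0 := by
        ext x y; simp [hp]
      rw [e, map_zero, LinearMap.zero_apply, zero_add]
      refine cv_word_eq_zero hl fun l₁ l₂ h₁ h₂ h => ?_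
      match l₁, h₁, h with
      | [], _, _ => simp [proj_one]
      | p :: l₁, _, h =>
        rw [List.length_cons] at h
        simp [ih l₂.length (by omega) l₂ h₂ rfl]
  refine linearMap_ext_word fun l hl => ?_
  simpa using key _ l hl rfl

variable {𝒱} in
theorem coder_ext [CharZero K] {q : ℤ} {Q Q' : Module.End K (SymCoalg 𝒱)}
    (hQ : Q ∈ coderComp 𝒱 q) (hQ' : Q' ∈ coderComp 𝒱 q)
    (hp : ∀ c, proj 𝒱 (Q c) = proj 𝒱 (Q' c)) : Q = Q' :=
  sub_eq_zero.1 (coder_eq_zero (sub_mem hQ hQ') fun c => by simp [hp])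

variable {𝒱} in
/-- An element of `Coder(SV)` is determined by its corestriction: the corestrictions of its
homogeneous components can be told apart by degree. -/
theorem coder_toEnd_ext [CharZero K] {Q Q' : Coder 𝒱}
    (hp : ∀ c, proj 𝒱 (toEnd (coderComp 𝒱) Q c) = proj 𝒱 (toEnd (coderComp 𝒱) Q' c)) :
    Q = Q' := by
  classical
  rw [← sub_eq_zero]
  set R := Q - Q' with hR
  have hp' : ∀ c, proj 𝒱 (toEnd (coderComp 𝒱) R c) = 0 := fun c => by simp [hR, hp]
  refine DFinsupp.ext fun n => Subtype.ext (coder_eq_zero (R n).2 ?_)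
  refine LinearMap.congr_fun (f := proj 𝒱 ∘ₗ (R n : Module.End K (SymCoalg 𝒱))) (g := 0)
    (linearMap_ext_gr fun j c hc => ?_)
  have h := hp' c
  have hdeg : ∀ i, proj 𝒱 ((R i : Module.End K (SymCoalg 𝒱)) c) ∈ 𝒱 (i + j) := fun i => by
    have := proj_isHomOfDeg 𝒱 _ _ ((R i).2.1 j c hc)
    rwa [zero_add] at this
  rw [toEnd, DirectSum.coeLinearMap_eq_dfinsuppSum, DFinsupp.sum, LinearMap.sum_apply, map_sum]
    at h
  have h2 := congrArg (fun z => ((DirectSum.decompose 𝒱 z (n + j) : 𝒱 (n + j)) : V)) h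
  simp only [DirectSum.decompose_sum, DirectSum.decompose_zero] at h2
  rw [DFinsupp.finsetSum_apply, AddSubmonoidClass.coe_finsetSum, Finset.sum_eq_single n] at h2
  · rw [DirectSum.decompose_of_mem_same 𝒱 (hdeg n)] at h2
    simpa using h2
  · intro i _ hi
    exact DirectSum.decompose_of_mem_ne 𝒱 (hdeg i) (by simpa using hi)
  · intro hn
    rw [DFinsupp.notMem_support_iff.1 hn]
    simp

end SymCoalg

end Coderivations

/-! ### The convolution bracket on maps `SV → H` -/

section Convolution

variable {K V H : Type*} [Field K] [AddCommGroup V] [Module K V] [AddCommGroup H] [Module K H]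

/-- The Jacobi identity, with the derivation acting from the right; `x` need not be homogeneous. -/
theorem GradedLieAlgebra.bracket_bracket_right (S : GradedLieAlgebra K H) (x : H)
    {j k : ℤ} {y z : H}
    (hy : y ∈ S.gr j) (hz : z ∈ S.gr k) :
    S.bracket (S.bracket x y) z =
      S.bracket x (S.bracket y z) + (-1 : K) ^ (j * k) • S.bracket (S.bracket x z) y := by
  induction x using DirectSum.Decomposition.inductionOn S.gr with
  | zero => simp
  | add x x' h h' =>
    simp only [map_add, LinearMap.add_apply, smul_add, h, h']
    abel
  | @homogeneous i x =>
    have h0 : (-1 : K) ≠ 0 := by simp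
    have h1 := neg_one_zpow_mul_self (K := K) (i * j)
    rw [S.jacobi x.2 hy hz, S.skew hy (S.bracket_mem x.2 hz), mul_add, zpow_add₀ h0, mul_comm j i]
    match_scalars
    · ring
    · linear_combination (-1 : K) ^ (j * k) * h1

variable (S : GradedLieAlgebra K H) (𝒱 : ℤ → Submodule K V)

/-- A graded Lie algebra `H` together with a decomposition `H = V ⊕ ker pr` of graded spaces into
two graded Lie subalgebras, the first one embedded by `inc`. -/
structure Splitting where
  inc : V →ₗ[K] H
  pr : H →ₗ[K] V
  inc_mem : ∀ {i : ℤ} {v : V}, v ∈ 𝒱 i → inc v ∈ S.gr i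
  pr_mem : ∀ {i : ℤ} {x : H}, x ∈ S.gr i → pr x ∈ 𝒱 i
  pr_inc : ∀ v, pr (inc v) = v
  inc_pr_bracket_inc : ∀ v w, inc (pr (S.bracket (inc v) (inc w))) = S.bracket (inc v) (inc w)
  pr_bracket_of_pr_eq_zero : ∀ x y, pr x = 0 → pr y = 0 → pr (S.bracket x y) = 0

open SymCoalg

variable {S 𝒱} in
/-- The generic point of `V`, as a map `SV → H`. -/
noncomputable def Splitting.pt (T : Splitting S 𝒱) : SymCoalg 𝒱 →ₗ[K] H := T.inc ∘ₗ proj 𝒱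

/-- The constant map `c ↦ ε(c) x`. -/
noncomputable def cst : H →ₗ[K] SymCoalg 𝒱 →ₗ[K] H :=
  (LinearMap.lsmul K H).flip.compl₂ (counit 𝒱).toLinearMap

variable {S} in
@[simp] theorem cst_apply (x : H) (c : SymCoalg 𝒱) : cst 𝒱 x c = counit 𝒱 c • x := rfl

theorem cst_isHomOfDeg {p : ℤ} {x : H} (hx : x ∈ S.gr p) : IsHomOfDeg 𝒱 S.gr p (cst 𝒱 x) := by
  intro i c hc
  refine mem_of_forall_word (fun l hl hi => ?_) hc
  cases l with
  | nil =>
    have : i = 0 := by simpa using hi.symm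
    simpa [this] using hx
  | cons p l => simp

variable {S 𝒱} in
theorem Splitting.pt_one (T : Splitting S 𝒱) : T.pt 1 = 0 := by simp [Splitting.pt, proj_one]

variable {S 𝒱} in
theorem Splitting.pt_comp_mulι (T : Splitting S 𝒱) (v : V) :
    T.pt ∘ₗ mulι 𝒱 v = cst 𝒱 (T.inc v) := by
  ext c; simp [Splitting.pt, proj_ι_mul]

variable {S 𝒱} in
theorem Splitting.pt_isHomOfDeg (T : Splitting S 𝒱) : IsHomOfDeg 𝒱 S.gr 0 T.pt :=
  fun i x hx => T.inc_mem (proj_isHomOfDeg 𝒱 i x hx)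

variable [DirectSum.Decomposition 𝒱]

/-- The convolution `c ↦ ∑ [f(c₍₁₎), g(c₍₂₎)]`, without Koszul signs. -/
noncomputable def conv :
    (SymCoalg 𝒱 →ₗ[K] H) →ₗ[K] (SymCoalg 𝒱 →ₗ[K] H) →ₗ[K] SymCoalg 𝒱 →ₗ[K] H :=
  LinearMap.mk₂ K (fun f g => cv 𝒱 (S.bracket.compl₁₂ f g))
    (fun f f' g => by rw [← map_add]; congr 1; ext x y; simp)
    (fun r f g => by rw [← map_smul]; congr 1; ext x y; simp)
    (fun f g g' => by rw [← map_add]; congr 1; ext x y; simp)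
    (fun r f g => by rw [← map_smul]; congr 1; ext x y; simp)

theorem conv_apply (f g : SymCoalg 𝒱 →ₗ[K] H) (c : SymCoalg 𝒱) :
    conv S 𝒱 f g c = cv 𝒱 (S.bracket.compl₁₂ f g) c := rfl

@[simp] theorem conv_one (f g : SymCoalg 𝒱 →ₗ[K] H) :
    conv S 𝒱 f g 1 = S.bracket (f 1) (g 1) := by
  simp [conv_apply]

theorem conv_ι_mul (f g : SymCoalg 𝒱 →ₗ[K] H) {i : ℤ} {v : V} (hv : v ∈ 𝒱 i)
    (c : SymCoalg 𝒱) : conv S 𝒱 f g (ι 𝒱 v * c) =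
      conv S 𝒱 (f ∘ₗ mulι 𝒱 v) g c + conv S 𝒱 (f ∘ₗ tw 𝒱 i) (g ∘ₗ mulι 𝒱 v) c := by
  rw [conv_apply, cv_ι_mul 𝒱 _ hv]
  rfl

theorem conv_comp_mulι (f g : SymCoalg 𝒱 →ₗ[K] H) {i : ℤ} {v : V} (hv : v ∈ 𝒱 i) :
    conv S 𝒱 f g ∘ₗ mulι 𝒱 v =
      conv S 𝒱 (f ∘ₗ mulι 𝒱 v) g + conv S 𝒱 (f ∘ₗ tw 𝒱 i) (g ∘ₗ mulι 𝒱 v) := by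
  ext c; exact conv_ι_mul S 𝒱 f g hv c

theorem conv_comp_tw (f g : SymCoalg 𝒱 →ₗ[K] H) (n : ℤ) :
    conv S 𝒱 f g ∘ₗ tw 𝒱 n = conv S 𝒱 (f ∘ₗ tw 𝒱 n) (g ∘ₗ tw 𝒱 n) := by
  ext c; exact cv_tw 𝒱 n _ c

theorem comp_tw_comp_tw (f : SymCoalg 𝒱 →ₗ[K] H) (p q : ℤ) :
    (f ∘ₗ tw 𝒱 p) ∘ₗ tw 𝒱 q = f ∘ₗ tw 𝒱 (p + q) := by
  rw [LinearMap.comp_assoc, tw_comp_tw]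

theorem comp_tw_comp_mulι (f : SymCoalg 𝒱 →ₗ[K] H) (n : ℤ) {i : ℤ} {v : V} (hv : v ∈ 𝒱 i) :
    (f ∘ₗ tw 𝒱 n) ∘ₗ mulι 𝒱 v = (-1 : K) ^ (n * i) • ((f ∘ₗ mulι 𝒱 v) ∘ₗ tw 𝒱 n) := by
  rw [LinearMap.comp_assoc, tw_comp_mulι 𝒱 n hv, LinearMap.comp_smul, LinearMap.comp_assoc]

@[simp] theorem cst_comp_tw (x : H) (n : ℤ) : cst 𝒱 x ∘ₗ tw 𝒱 n = cst 𝒱 x := by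
  ext c; simp

theorem conv_cst (f : SymCoalg 𝒱 →ₗ[K] H) (x : H) :
    conv S 𝒱 f (cst 𝒱 x) = S.bracket.flip x ∘ₗ f := by
  ext c
  refine Eq.trans ?_ (cv_counit_right 𝒱 (S.bracket.flip x ∘ₗ f) c)
  rw [conv_apply]
  congr 2
  ext x y
  simp

theorem conv_cst_cst (x y : H) : conv S 𝒱 (cst 𝒱 x) (cst 𝒱 y) = cst 𝒱 (S.bracket x y) := by
  rw [conv_cst]
  ext c
  simp

theorem conv_isHomOfDeg {p q : ℤ} {f g : SymCoalg 𝒱 →ₗ[K] H} (hf : IsHomOfDeg 𝒱 S.gr p f)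
    (hg : IsHomOfDeg 𝒱 S.gr q g) : IsHomOfDeg 𝒱 S.gr (p + q) (conv S 𝒱 f g) := by
  have key : ∀ l, IsHomList 𝒱 l → ∀ (p q : ℤ) (f g : SymCoalg 𝒱 →ₗ[K] H),
      IsHomOfDeg 𝒱 S.gr p f → IsHomOfDeg 𝒱 S.gr q g →
      conv S 𝒱 f g (word 𝒱 l) ∈ S.gr (p + q + (l.map Prod.fst).sum) := by
    intro l hl
    induction l with
    | nil =>
      intro p q f g hf hg
      have h1 := hf 0 1 SetLike.GradedOne.one_mem
      have h2 := hg 0 1 SetLike.GradedOne.one_mem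
      rw [add_zero] at h1 h2
      simpa using S.bracket_mem h1 h2
    | cons r l ih =>
      intro p q f g hf hg
      rw [word_cons, conv_ι_mul S 𝒱 f g hl.head, List.map_cons, List.sum_cons, ← add_assoc]
      refine add_mem ?_ ?_
      · have := ih hl.tail _ _ _ _ (hf.comp_mulι hl.head) hg
        rwa [add_right_comm p] at this
      · have := ih hl.tail _ _ _ _ (hf.comp_tw r.1) (hg.comp_mulι hl.head)
        rwa [← add_assoc] at this
  intro i x hx
  refine mem_of_forall_word (fun l hl hi => ?_) hx
  subst hi
  exact key l hl p q f g hf hg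

/-- Graded antisymmetry of the convolution bracket. -/
theorem conv_skew {p q : ℤ} {f g : SymCoalg 𝒱 →ₗ[K] H} (hf : IsHomOfDeg 𝒱 S.gr p f)
    (hg : IsHomOfDeg 𝒱 S.gr q g) :
    conv S 𝒱 (f ∘ₗ tw 𝒱 q) g = -((-1 : K) ^ (p * q) • conv S 𝒱 (g ∘ₗ tw 𝒱 p) f) := by
  ext c
  induction c using induction_on (𝒱 := 𝒱) generalizing p q f g with
  | one =>
    have h1 := hf 0 1 SetLike.GradedOne.one_mem
    have h2 := hg 0 1 SetLike.GradedOne.one_mem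
    rw [add_zero] at h1 h2
    simpa using S.skew h1 h2
  | zero => simp
  | add x y hx hy => simp only [map_add, hx hf hg, hy hf hg]
  | smul r x hx => simp only [map_smul, hx hf hg]
  | ι_mul i v hv c ih =>
    have e1 := ih (hf.comp_mulι hv) hg
    have e2 := ih hf (hg.comp_mulι hv)
    have h1 := neg_one_zpow_mul_self (K := K) (p * i)
    have h2 := neg_one_zpow_mul_self (K := K) (q * i)
    have h0 : (-1 : K) ≠ 0 := by simp
    simp only [LinearMap.neg_apply, LinearMap.smul_apply] at e1 e2 ⊢
    rw [conv_ι_mul S 𝒱 _ _ hv, conv_ι_mul S 𝒱 _ _ hv, comp_tw_comp_mulι _ _ _ hv,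
      comp_tw_comp_mulι _ _ _ hv, comp_tw_comp_tw, comp_tw_comp_tw, map_smul, map_smul,
      LinearMap.smul_apply, LinearMap.smul_apply, LinearMap.smul_apply, LinearMap.smul_apply, e1,
      e2]
    simp only [add_mul, mul_add, zpow_add₀ h0, mul_comm i q]
    match_scalars
    · linear_combination (-(-1 : K) ^ (p * q)) * h2
    · ring

/-- A coderivation acts on the convolution by the Leibniz rule. -/
theorem conv_comp_coder {q : ℤ} {Q : Module.End K (SymCoalg 𝒱)} (hQ : Q ∈ coderComp 𝒱 q)
    (f g : SymCoalg 𝒱 →ₗ[K] H) :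
    conv S 𝒱 f g ∘ₗ Q = conv S 𝒱 (f ∘ₗ Q) g + conv S 𝒱 (f ∘ₗ tw 𝒱 q) (g ∘ₗ Q) := by
  ext c; exact cv_coder hQ _ c

/-- The derivation `[·, a]` applied to a convolution. -/
theorem bracket_conv {q i : ℤ} {a : H} (ha : a ∈ S.gr i) {f g : SymCoalg 𝒱 →ₗ[K] H}
    (hg : IsHomOfDeg 𝒱 S.gr q g) (c : SymCoalg 𝒱) :
    S.bracket (conv S 𝒱 f (g ∘ₗ tw 𝒱 i) c) a =
      (-1 : K) ^ (q * i) • conv S 𝒱 (S.bracket.flip a ∘ₗ f) g c +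
        conv S 𝒱 f (S.bracket.flip a ∘ₗ g ∘ₗ tw 𝒱 i) c := by
  rw [← LinearMap.flip_apply, conv_apply, map_cv, conv_apply, conv_apply, smul_cv,
    ← LinearMap.add_apply, ← map_add]
  congr 2
  refine LinearMap.ext fun x => linearMap_ext_gr fun j y hy => ?_
  have h := S.bracket_bracket_right (f x) (hg j y hy) ha
  have h1 := neg_one_zpow_mul_self (K := K) (i * j)
  simp only [LinearMap.compr₂_apply, LinearMap.compl₁₂_apply, LinearMap.comp_apply, tw,
    twist_of_mem _ i hy, map_smul, LinearMap.flip_apply, LinearMap.smul_apply,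
    LinearMap.add_apply, h, add_mul, zpow_add₀ (show (-1 : K) ≠ 0 by simp), mul_comm j i]
  match_scalars
  · ring
  · linear_combination (-1 : K) ^ (q * i) * h1

variable {S 𝒱} (T : Splitting S 𝒱)

/-- The graded Jacobi identity for convolution with the generic point, which has degree `0`. -/
theorem conv_conv_pt {q : ℤ} (f : SymCoalg 𝒱 →ₗ[K] H) {g : SymCoalg 𝒱 →ₗ[K] H}
    (hg : IsHomOfDeg 𝒱 S.gr q g) :
    conv S 𝒱 (conv S 𝒱 f g) T.pt =
      conv S 𝒱 (conv S 𝒱 f (T.pt ∘ₗ tw 𝒱 q)) g + conv S 𝒱 f (conv S 𝒱 g T.pt) := by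
  ext c
  induction c using induction_on (𝒱 := 𝒱) generalizing q f g with
  | one => simp [T.pt_one]
  | zero => simp
  | add x y hx hy => simp only [map_add, hx f hg, hy f hg]
  | smul r x hx => simp only [map_smul, hx f hg]
  | ι_mul i v hv c ih =>
    have e1 := ih (f ∘ₗ mulι 𝒱 v) hg
    have e2 := ih (f ∘ₗ tw 𝒱 i) (hg.comp_mulι hv)
    have e3 := bracket_conv S 𝒱 (T.inc_mem hv) (f := f ∘ₗ tw 𝒱 i) hg c
    simp only [LinearMap.add_apply, conv_ι_mul S 𝒱 _ _ hv, conv_comp_mulι S 𝒱 _ _ hv,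
      conv_comp_tw, T.pt_comp_mulι, conv_cst, comp_tw_comp_mulι _ _ _ hv, comp_tw_comp_tw,
      map_add, map_smul, LinearMap.smul_apply, cst_comp_tw] at e1 e2 e3 ⊢
    rw [e1, e2, LinearMap.comp_apply, LinearMap.flip_apply, e3]
    abel

variable (S 𝒱) in
/-- The bracket `[f, g]` of maps `SV → H`, where `g` has degree `q`, with its Koszul sign. -/
noncomputable def gconv (q : ℤ) :
    (SymCoalg 𝒱 →ₗ[K] H) →ₗ[K] (SymCoalg 𝒱 →ₗ[K] H) →ₗ[K] SymCoalg 𝒱 →ₗ[K] H :=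
  conv S 𝒱 ∘ₗ LinearMap.lcomp K H (tw 𝒱 q)

theorem gconv_eq (q : ℤ) (f g : SymCoalg 𝒱 →ₗ[K] H) :
    gconv S 𝒱 q f g = conv S 𝒱 (f ∘ₗ tw 𝒱 q) g := rfl

/-- The operator `R = [·, x]`, where `x` is the generic point. -/
noncomputable def Splitting.adPt : Module.End K (SymCoalg 𝒱 →ₗ[K] H) := (conv S 𝒱).flip T.pt

theorem Splitting.adPt_eq (f : SymCoalg 𝒱 →ₗ[K] H) : T.adPt f = conv S 𝒱 f T.pt := rfl

theorem Splitting.adPt_isHomOfDeg {p : ℤ} {f : SymCoalg 𝒱 →ₗ[K] H}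
    (hf : IsHomOfDeg 𝒱 S.gr p f) : IsHomOfDeg 𝒱 S.gr p (T.adPt f) := by
  have h := conv_isHomOfDeg S 𝒱 hf T.pt_isHomOfDeg
  rwa [add_zero] at h

theorem Splitting.adPt_pow_isHomOfDeg {p : ℤ} {f : SymCoalg 𝒱 →ₗ[K] H}
    (hf : IsHomOfDeg 𝒱 S.gr p f) (k : ℕ) : IsHomOfDeg 𝒱 S.gr p ((T.adPt ^ k) f) := by
  induction k with
  | zero => simpa using hf
  | succ k ih =>
    rw [pow_succ', Module.End.mul_apply]
    exact T.adPt_isHomOfDeg ih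

/-- `R` is a derivation of the bracket. -/
theorem Splitting.adPt_gconv {q : ℤ} (f : SymCoalg 𝒱 →ₗ[K] H) {g : SymCoalg 𝒱 →ₗ[K] H}
    (hg : IsHomOfDeg 𝒱 S.gr q g) :
    T.adPt (gconv S 𝒱 q f g) = gconv S 𝒱 q (T.adPt f) g + gconv S 𝒱 q f (T.adPt g) := by
  simp only [gconv_eq, T.adPt_eq, conv_comp_tw]
  exact conv_conv_pt T _ hg

theorem gconv_skew {p q : ℤ} {f g : SymCoalg 𝒱 →ₗ[K] H} (hf : IsHomOfDeg 𝒱 S.gr p f)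
    (hg : IsHomOfDeg 𝒱 S.gr q g) :
    gconv S 𝒱 q f g = -((-1 : K) ^ (p * q) • gconv S 𝒱 p g f) :=
  conv_skew S 𝒱 hf hg

/-- Leibniz formula for the powers of `R`. -/
theorem Splitting.adPt_pow_gconv {q : ℤ} (f : SymCoalg 𝒱 →ₗ[K] H) {g : SymCoalg 𝒱 →ₗ[K] H}
    (hg : IsHomOfDeg 𝒱 S.gr q g) (k : ℕ) :
    (T.adPt ^ k) (gconv S 𝒱 q f g) = ∑ x ∈ Finset.HasAntidiagonal.antidiagonal k,
      k.choose x.1 • gconv S 𝒱 q ((T.adPt ^ x.1) f) ((T.adPt ^ x.2) g) := by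
  induction k with
  | zero => simp
  | succ k ih =>
    rw [Finset.sum_antidiagonal_choose_succ_nsmul
      (fun a s => gconv S 𝒱 q ((T.adPt ^ a) f) ((T.adPt ^ s) g)), pow_succ', Module.End.mul_apply,
      ih, map_sum, ← Finset.sum_add_distrib]
    refine Finset.sum_congr rfl fun x hx => ?_
    rw [map_nsmul, T.adPt_gconv _ (T.adPt_pow_isHomOfDeg hg _), smul_add, add_comm,
      Nat.choose_symm_of_eq_add (Finset.HasAntidiagonal.mem_antidiagonal.1 hx).symm]
    simp only [pow_succ', Module.End.mul_apply]

/-- The commutator of the powers of `R` with a coderivation `Q`; here `u = pt ∘ Q` is the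
derivative of the generic point along `Q`. -/
theorem Splitting.adPt_pow_comp_coder {q : ℤ} {Q : Module.End K (SymCoalg 𝒱)}
    (hQ : Q ∈ coderComp 𝒱 q) {u : SymCoalg 𝒱 →ₗ[K] H} (hu : T.pt ∘ₗ Q = u)
    (f : SymCoalg 𝒱 →ₗ[K] H) (k : ℕ) :
    ((T.adPt ^ (k + 1)) f) ∘ₗ Q = (T.adPt ^ (k + 1)) (f ∘ₗ Q) +
      ∑ x ∈ Finset.HasAntidiagonal.antidiagonal k,
        (k + 1).choose (x.2 + 1) • gconv S 𝒱 q ((T.adPt ^ x.1) f) ((T.adPt ^ x.2) u) := by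
  have hdeg : IsHomOfDeg 𝒱 S.gr q u := by
    intro i x hx
    subst hu
    simpa using T.pt_isHomOfDeg _ _ (hQ.1 i x hx)
  have h1 : ∀ f, (T.adPt f) ∘ₗ Q = T.adPt (f ∘ₗ Q) + gconv S 𝒱 q f u := fun f => by
    rw [T.adPt_eq, conv_comp_coder S 𝒱 hQ, hu]
    rfl
  induction k with
  | zero => simp [h1]
  | succ k ih =>
    rw [pow_succ', Module.End.mul_apply, h1, ih, map_add, map_sum]
    have e : ∀ x : ℕ × ℕ, (k + 1 + 1).choose (x.2 + 1) •
        gconv S 𝒱 q ((T.adPt ^ x.1) f) ((T.adPt ^ x.2) u) =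
        (k + 1).choose (x.2 + 1) • gconv S 𝒱 q ((T.adPt ^ x.1) f) ((T.adPt ^ x.2) u) +
        (k + 1).choose x.2 • gconv S 𝒱 q ((T.adPt ^ x.1) f) ((T.adPt ^ x.2) u) := fun x => by
      rw [Nat.choose_succ_succ, add_smul, add_comm]
    simp only [e]
    rw [Finset.sum_add_distrib, Finset.Nat.sum_antidiagonal_succ,
      Finset.Nat.sum_antidiagonal_succ' (n := k) (f := fun x : ℕ × ℕ => (k + 1).choose x.2 •
        gconv S 𝒱 q ((T.adPt ^ x.1) f) ((T.adPt ^ x.2) u))]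
    simp only [map_nsmul, T.adPt_gconv _ (T.adPt_pow_isHomOfDeg hdeg _), smul_add,
      Finset.sum_add_distrib, pow_succ' T.adPt, Module.End.mul_apply, pow_zero,
      Module.End.one_apply,
      Nat.choose_succ_self, zero_smul, zero_add, Nat.choose_zero_right, one_smul]
    abel

end Convolution

/-! ### Power series in the operator `R` -/

section PowerSeriesAction

variable {K V H : Type*} [Field K] [AddCommGroup V] [Module K V] [AddCommGroup H] [Module K H]
variable {S : GradedLieAlgebra K H} {𝒱 : ℤ → Submodule K V} [DirectSum.Decomposition 𝒱]
variable (T : Splitting S 𝒱)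

open SymCoalg Finset

omit [DirectSum.Decomposition 𝒱] in
theorem Splitting.pt_word_eq_zero {l : List (ℤ × V)} (hl : l.length ≠ 1) :
    T.pt (word 𝒱 l) = 0 := by
  match l, hl with
  | [], _ => simp [T.pt_one]
  | p :: p' :: l, _ => simp [Splitting.pt, proj_ι_mul]

theorem Splitting.adPt_pow_word_eq_zero (k : ℕ) (f : SymCoalg 𝒱 →ₗ[K] H) {l : List (ℤ × V)}
    (hl : IsHomList 𝒱 l) (hk : l.length < k) : (T.adPt ^ k) f (word 𝒱 l) = 0 := by
  induction k generalizing l with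
  | zero => omega
  | succ k ih =>
    rw [pow_succ', Module.End.mul_apply, T.adPt_eq, conv_apply]
    refine cv_word_eq_zero hl fun l₁ l₂ h₁ h₂ h => ?_
    rcases eq_or_ne l₂.length 1 with h' | h'
    · simp [ih h₁ (by omega)]
    · simp [T.pt_word_eq_zero h']

/-- `R` is locally nilpotent: at each point only finitely many of its powers are nonzero. -/
theorem Splitting.exists_adPt_pow_eq_zero (c : SymCoalg 𝒱) :
    ∃ N : ℕ, ∀ k, N ≤ k → ∀ f, (T.adPt ^ k) f c = 0 := by
  induction c using word_induction (𝒱 := 𝒱) with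
  | word l hl => exact ⟨l.length + 1, fun k hk f => T.adPt_pow_word_eq_zero k f hl hk⟩
  | zero => exact ⟨0, by simp⟩
  | add x y hx hy =>
    obtain ⟨N, hN⟩ := hx
    obtain ⟨N', hN'⟩ := hy
    exact ⟨max N N', fun k hk f => by
      rw [map_add, hN k (le_of_max_le_left hk), hN' k (le_of_max_le_right hk), add_zero]⟩
  | smul r x hx =>
    obtain ⟨N, hN⟩ := hx
    exact ⟨N, fun k hk f => by rw [map_smul, hN k hk, smul_zero]⟩

theorem Splitting.support_finite (s : ℕ → K) (f : SymCoalg 𝒱 →ₗ[K] H) (c : SymCoalg 𝒱) :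
    (Function.support fun k => s k • (T.adPt ^ k) f c).Finite := by
  obtain ⟨N, hN⟩ := T.exists_adPt_pow_eq_zero c
  refine (Set.finite_lt_nat N).subset fun k hk => ?_
  by_contra h
  exact hk (by simp [hN k (not_lt.1 h)])

/-- The action `s(R) f = ∑ s_k R^k f` of a power series `s` on maps `SV → H`. The sum is finite at
each point of `SV`. -/
noncomputable def Splitting.ps (s : PowerSeries K) :
    (SymCoalg 𝒱 →ₗ[K] H) →ₗ[K] SymCoalg 𝒱 →ₗ[K] H :=
  LinearMap.mk₂ K (fun f c => ∑ᶠ k, PowerSeries.coeff k s • (T.adPt ^ k) f c)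
    (fun f g c => by
      rw [← finsum_add_distrib (T.support_finite _ f c) (T.support_finite _ g c)]
      simp)
    (fun r f c => by
      rw [smul_finsum' _ (T.support_finite _ f c)]
      simp [smul_comm r])
    (fun f c d => by
      rw [← finsum_add_distrib (T.support_finite _ f c) (T.support_finite _ f d)]
      simp)
    (fun r f c => by
      rw [smul_finsum' _ (T.support_finite _ f c)]
      simp [smul_comm r])

theorem Splitting.ps_apply (s : PowerSeries K) (f : SymCoalg 𝒱 →ₗ[K] H) (c : SymCoalg 𝒱) :
    T.ps s f c = ∑ᶠ k, PowerSeries.coeff k s • (T.adPt ^ k) f c := rfl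

theorem Splitting.ps_mem (s : PowerSeries K) {f : SymCoalg 𝒱 →ₗ[K] H} {c : SymCoalg 𝒱}
    {W : Submodule K H} (h : ∀ k, (T.adPt ^ k) f c ∈ W) : T.ps s f c ∈ W := by
  rw [T.ps_apply]
  exact finsum_induction (· ∈ W) (zero_mem W) (fun _ _ hx hy => add_mem hx hy)
    fun k => W.smul_mem _ (h k)

theorem Splitting.ps_isHomOfDeg (s : PowerSeries K) {p : ℤ} {f : SymCoalg 𝒱 →ₗ[K] H}
    (hf : IsHomOfDeg 𝒱 S.gr p f) : IsHomOfDeg 𝒱 S.gr p (T.ps s f) :=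
  fun i x hx => T.ps_mem s fun k => T.adPt_pow_isHomOfDeg hf k i x hx

section Topology

-- With the discrete topology on `H`, `HasSum` expresses sums with finite support.
variable [TopologicalSpace H]

theorem Splitting.hasSum_ps (s : PowerSeries K) (f : SymCoalg 𝒱 →ₗ[K] H) (c : SymCoalg 𝒱) :
    HasSum (fun k => PowerSeries.coeff k s • (T.adPt ^ k) f c) (T.ps s f c) := by
  have h := T.support_finite (fun k => PowerSeries.coeff k s) f c
  rw [T.ps_apply, finsum_eq_sum_of_support_toFinset_subset _ h (subset_refl _)]
  exact hasSum_sum_of_ne_finset_zero fun k hk => by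
    simpa only [Set.Finite.mem_toFinset, Function.notMem_support] using hk

variable [DiscreteTopology H]

theorem hasSum_antidiagonal {u : ℕ × ℕ → H} {a : H} (h : HasSum u a) :
    HasSum (fun k => ∑ x ∈ antidiagonal k, u x) a := by
  have h' := (HasAntidiagonal.sigmaAntidiagonalEquivProd.hasSum_iff (f := u)).2 h
  refine h'.sigma fun k => ?_
  exact (antidiagonal k).hasSum u

/-- The Cauchy product of two power series in `R`, applied to the bracket. -/
theorem Splitting.hasSum_gconv (s t : PowerSeries K) (q : ℤ) (f g : SymCoalg 𝒱 →ₗ[K] H)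
    (c : SymCoalg 𝒱) :
    HasSum (fun k => ∑ x ∈ antidiagonal k, (PowerSeries.coeff x.1 s * PowerSeries.coeff x.2 t) •
      gconv S 𝒱 q ((T.adPt ^ x.1) f) ((T.adPt ^ x.2) g) c)
      (gconv S 𝒱 q (T.ps s f) (T.ps t g) c) := by
  refine hasSum_antidiagonal (u := fun x : ℕ × ℕ => (PowerSeries.coeff x.1 s *
    PowerSeries.coeff x.2 t) • gconv S 𝒱 q ((T.adPt ^ x.1) f) ((T.adPt ^ x.2) g) c) ?_
  simp only [gconv_eq, conv_apply, cv_apply]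
  generalize comul 𝒱 c = z
  induction z using TensorProduct.induction_on with
  | zero => simp
  | add z z' h h' => simpa only [map_add, smul_add] using h.add h'
  | tmul x y =>
    obtain ⟨N, hN⟩ := T.exists_adPt_pow_eq_zero (tw 𝒱 q x)
    obtain ⟨N', hN'⟩ := T.exists_adPt_pow_eq_zero y
    have e1 : T.ps s f (tw 𝒱 q x) =
        ∑ k ∈ range N, PowerSeries.coeff k s • (T.adPt ^ k) f (tw 𝒱 q x) :=
      (T.hasSum_ps s f _).unique (hasSum_sum_of_ne_finset_zero fun k hk => by
        rw [hN k (by simpa using hk), smul_zero])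
    have e2 : T.ps t g y = ∑ k ∈ range N', PowerSeries.coeff k t • (T.adPt ^ k) g y :=
      (T.hasSum_ps t g _).unique (hasSum_sum_of_ne_finset_zero fun k hk => by
        rw [hN' k (by simpa using hk), smul_zero])
    have e3 : S.bracket (T.ps s f (tw 𝒱 q x)) (T.ps t g y) = ∑ k ∈ range N ×ˢ range N',
        (PowerSeries.coeff k.1 s * PowerSeries.coeff k.2 t) •
          S.bracket ((T.adPt ^ k.1) f (tw 𝒱 q x)) ((T.adPt ^ k.2) g y) := by
      rw [e1, e2, sum_product, map_sum S.bracket, LinearMap.sum_apply]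
      refine sum_congr rfl fun k _ => ?_
      rw [map_sum]
      refine sum_congr rfl fun k' _ => ?_
      simp [smul_smul, mul_comm]
    simp only [TensorProduct.lift.tmul, LinearMap.compl₁₂_apply, LinearMap.comp_apply, e3]
    refine hasSum_sum_of_ne_finset_zero fun k hk => ?_
    rw [mem_product, mem_range, mem_range, not_and_or, not_lt, not_lt] at hk
    rcases hk with hk | hk
    · rw [hN _ hk, map_zero, LinearMap.zero_apply, smul_zero]
    · rw [hN' _ hk, map_zero, smul_zero]

end Topology

theorem Splitting.adPt_ps (s : PowerSeries K) (f : SymCoalg 𝒱 →ₗ[K] H) :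
    T.adPt (T.ps s f) = T.ps s (T.adPt f) := by
  let _ : TopologicalSpace H := ⊥
  have _ : DiscreteTopology H := ⟨rfl⟩
  ext c
  refine HasSum.unique (L := .unconditional ℕ)
    (f := fun k => PowerSeries.coeff k s • (T.adPt ^ (k + 1)) f c) ?_ ?_
  · simp only [pow_succ', Module.End.mul_apply]
    simp only [T.adPt_eq, conv_apply, cv_apply]
    generalize comul 𝒱 c = z
    induction z using TensorProduct.induction_on with
    | zero => simp
    | add z z' h h' => simpa only [map_add, smul_add] using h.add h'
    | tmul x y =>
      have h := (T.hasSum_ps s f x).map (S.bracket.flip (T.pt y)) continuous_of_discreteTopology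
      simpa [Function.comp_def] using h
  · simpa only [pow_succ, Module.End.mul_apply] using T.hasSum_ps s (T.adPt f) c

theorem Splitting.adPt_pow_ps (s : PowerSeries K) (f : SymCoalg 𝒱 →ₗ[K] H) (k : ℕ) :
    (T.adPt ^ k) (T.ps s f) = T.ps s ((T.adPt ^ k) f) := by
  induction k with
  | zero => simp
  | succ k ih => rw [pow_succ', Module.End.mul_apply, Module.End.mul_apply, ih, T.adPt_ps]

theorem Splitting.ps_mul (s t : PowerSeries K) (f : SymCoalg 𝒱 →ₗ[K] H) :
    T.ps (s * t) f = T.ps s (T.ps t f) := by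
  let _ : TopologicalSpace H := ⊥
  have _ : DiscreteTopology H := ⟨rfl⟩
  ext c
  obtain ⟨N, hN⟩ := T.exists_adPt_pow_eq_zero c
  have e1 : T.ps s (T.ps t f) c = ∑ x ∈ range N ×ˢ range N,
      (PowerSeries.coeff x.1 s * PowerSeries.coeff x.2 t) • (T.adPt ^ (x.1 + x.2)) f c := by
    rw [(T.hasSum_ps s (T.ps t f) c).unique (hasSum_sum_of_ne_finset_zero (s := range N)
      fun k hk => by rw [hN k (by simpa using hk), smul_zero]), sum_product]
    refine sum_congr rfl fun k _ => ?_
    rw [T.adPt_pow_ps, (T.hasSum_ps t ((T.adPt ^ k) f) c).unique (hasSum_sum_of_ne_finset_zero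
      (s := range N) fun k hk => by rw [hN k (by simpa using hk), smul_zero]), smul_sum]
    refine sum_congr rfl fun l _ => ?_
    rw [smul_smul, add_comm, pow_add, Module.End.mul_apply]
  have e2 : HasSum (fun x : ℕ × ℕ => (PowerSeries.coeff x.1 s * PowerSeries.coeff x.2 t) •
      (T.adPt ^ (x.1 + x.2)) f c) (T.ps s (T.ps t f) c) := by
    rw [e1]
    refine hasSum_sum_of_ne_finset_zero fun k hk => ?_
    rw [mem_product, mem_range, mem_range, not_and_or, not_lt, not_lt] at hk
    rw [hN _ (by omega), smul_zero]
  refine (T.hasSum_ps (s * t) f c).unique ?_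
  convert hasSum_antidiagonal e2 using 2 with k
  rw [PowerSeries.coeff_mul, sum_smul]
  refine sum_congr rfl fun x hx => ?_
  rw [mem_antidiagonal.1 hx]

theorem Splitting.ps_one (f : SymCoalg 𝒱 →ₗ[K] H) : T.ps 1 f = f := by
  ext c
  rw [T.ps_apply, finsum_eq_single _ 0 fun k hk => by simp [PowerSeries.coeff_one, hk]]
  simp

end PowerSeriesAction

/-! ### The coderivations attached to a splitting -/

section Derived

variable {K V H : Type*} [Field K] [AddCommGroup V] [Module K V]
variable [AddCommGroup H] [Module K H]
variable {S : GradedLieAlgebra K H} {𝒱 : ℤ → Submodule K V} (T : Splitting S 𝒱)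

open SymCoalg Finset

/-- The projection of `H` onto the image of `V`. -/
def Splitting.proj : H →ₗ[K] H := T.inc ∘ₗ T.pr

theorem Splitting.proj_comp_proj (f : SymCoalg 𝒱 →ₗ[K] H) :
    T.proj ∘ₗ (T.proj ∘ₗ f) = T.proj ∘ₗ f := by
  ext c; simp [Splitting.proj, T.pr_inc]

/-- The projection of the bracket of two elements, in terms of their components. -/
theorem Splitting.proj_bracket (x y : H) :
    T.proj (S.bracket x (T.proj y)) + T.proj (S.bracket (T.proj x) y) -
      S.bracket (T.proj x) (T.proj y) = T.proj (S.bracket x y) := by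
  have h1 : T.proj (S.bracket (T.proj x) (T.proj y)) = S.bracket (T.proj x) (T.proj y) :=
    T.inc_pr_bracket_inc _ _
  have h2 : T.proj (S.bracket (x - T.proj x) (y - T.proj y)) = 0 := by
    simp only [Splitting.proj, LinearMap.comp_apply]
    rw [T.pr_bracket_of_pr_eq_zero _ _ (by simp [T.pr_inc]) (by simp [T.pr_inc]), map_zero]
  simp only [map_sub, LinearMap.sub_apply, h1] at h2
  rw [← sub_eq_zero, ← neg_eq_zero, ← h2]
  abel

variable [DirectSum.Decomposition 𝒱]

/-- The same identity for the bracket of maps `SV → H`. -/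
theorem Splitting.proj_gconv (q : ℤ) (f g : SymCoalg 𝒱 →ₗ[K] H) :
    T.proj ∘ₗ gconv S 𝒱 q f (T.proj ∘ₗ g) + T.proj ∘ₗ gconv S 𝒱 q (T.proj ∘ₗ f) g -
      gconv S 𝒱 q (T.proj ∘ₗ f) (T.proj ∘ₗ g) = T.proj ∘ₗ gconv S 𝒱 q f g := by
  ext c
  simp only [gconv_eq, LinearMap.add_apply, LinearMap.sub_apply, LinearMap.comp_apply, conv_apply,
    map_cv]
  rw [← LinearMap.add_apply, ← map_add, ← LinearMap.sub_apply, ← map_sub]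
  congr 2
  ext x y
  exact T.proj_bracket (f (tw 𝒱 q x)) (g y)

/-- Since the image of `V` is a subalgebra, `R` preserves the maps with values in it. -/
theorem Splitting.adPt_inc (f : SymCoalg 𝒱 →ₗ[K] H) (hf : T.proj ∘ₗ f = f) :
    T.proj ∘ₗ T.adPt f = T.adPt f := by
  rw [T.adPt_eq]
  ext c
  rw [LinearMap.comp_apply, conv_apply, map_cv]
  congr 2
  ext x y
  have h : f x = T.inc (T.pr (f x)) := (LinearMap.congr_fun hf x).symm
  simp only [LinearMap.compr₂_apply, LinearMap.compl₁₂_apply]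
  rw [h]
  exact T.inc_pr_bracket_inc _ _

theorem Splitting.ps_inc (s : PowerSeries K) (f : SymCoalg 𝒱 →ₗ[K] H) (hf : T.proj ∘ₗ f = f) :
    T.proj ∘ₗ T.ps s f = T.ps s f := by
  have hk : ∀ k, T.proj ∘ₗ (T.adPt ^ k) f = (T.adPt ^ k) f := by
    intro k
    induction k with
    | zero => simpa using hf
    | succ k ih =>
      rw [pow_succ', Module.End.mul_apply]
      exact T.adPt_inc _ ih
  ext c
  have h := T.ps_mem s (f := f) (c := c) (W := LinearMap.ker (T.proj - LinearMap.id))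
    fun k => by
      rw [LinearMap.mem_ker, LinearMap.sub_apply, sub_eq_zero]
      exact LinearMap.congr_fun (hk k) c
  rw [LinearMap.mem_ker, LinearMap.sub_apply, sub_eq_zero] at h
  exact h

theorem Splitting.pt_comp_coderOf (φ : SymCoalg 𝒱 →ₗ[K] V) :
    T.pt ∘ₗ coderOf 𝒱 φ = T.inc ∘ₗ φ := by
  ext c; simp [Splitting.pt, proj_coderOf]

variable [CharZero K]

variable (K) in
/-- The power series `(e^t - 1) / t`. -/
noncomputable def expQuot : PowerSeries K :=
  PowerSeries.mk fun n => ((n + 1).factorial : K)⁻¹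

theorem bernoulli_mul_expQuot : bernoulliPowerSeries K * expQuot K = 1 := by
  have h : expQuot K * PowerSeries.X = PowerSeries.exp K - 1 := by
    ext n
    cases n with
    | zero => simp
    | succ n => simp [expQuot, PowerSeries.coeff_succ_mul_X, PowerSeries.coeff_exp,
        PowerSeries.coeff_one]
  have h2 := bernoulliPowerSeries_mul_exp_sub_one K
  rw [← h, ← mul_assoc] at h2
  -- both sides agree after multiplication with `t`
  exact mul_right_cancel₀ PowerSeries.X_ne_zero (h2.trans (one_mul _).symm)

theorem coeff_exp_eq (n : ℕ) : PowerSeries.coeff n (PowerSeries.exp K) = (n.factorial : K)⁻¹ := by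
  simp [PowerSeries.coeff_exp]

/-- The coefficient of `[R^a f, R^s u]` in the derivative of `e^R f`. -/
theorem choose_div_factorial (a s : ℕ) :
    ((a + s + 1).factorial : K)⁻¹ * ((a + s + 1).choose (s + 1) : K) =
      (a.factorial : K)⁻¹ * ((s + 1).factorial : K)⁻¹ := by
  have h := Nat.add_choose_mul_factorial_mul_factorial a (s + 1)
  rw [← add_assoc] at h
  have h' : ((a + s + 1).choose (s + 1) : K) * a.factorial * (s + 1).factorial =
      (a + s + 1).factorial := by exact_mod_cast h
  have := Nat.cast_ne_zero (R := K).2 (Nat.factorial_ne_zero a)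
  have := Nat.cast_ne_zero (R := K).2 (Nat.factorial_ne_zero (s + 1))
  have := Nat.cast_ne_zero (R := K).2 (Nat.factorial_ne_zero (a + s + 1))
  field_simp
  linear_combination h'

/-- The coefficient of `[R^a u₁, R^s u₂]` in the Maurer-Cartan equation. -/
theorem choose_add_choose_div_factorial (a s : ℕ) :
    ((a + s + 2).factorial : K)⁻¹ *
        (((a + s + 1).choose (s + 1) : K) + ((a + s + 1).choose (a + 1) : K)) =
      ((a + 1).factorial : K)⁻¹ * ((s + 1).factorial : K)⁻¹ := by
  have h := choose_div_factorial (K := K) (a + 1) s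
  rw [← h, show a + 1 + s + 1 = a + s + 2 by omega]
  congr 1
  rw [Nat.choose_succ_succ (a + s + 1) s,
    show (a + s + 1).choose (a + 1) = (a + s + 1).choose s from
    Nat.choose_symm_of_eq_add (by omega)]
  push_cast
  ring

/-- The map `e^R x` attached to `x ∈ H`: the element `x` transported to the generic point. -/
noncomputable def Splitting.transport : H →ₗ[K] SymCoalg 𝒱 →ₗ[K] H :=
  T.ps (PowerSeries.exp K) ∘ₗ cst 𝒱

/-- The corestriction `φ(x) = b(R) P e^R x : SV → V`, where `b(t) = t / (e^t - 1)`. -/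
noncomputable def Splitting.coeffs : H →ₗ[K] SymCoalg 𝒱 →ₗ[K] V :=
  T.pr.compRight K ∘ₗ T.ps (bernoulliPowerSeries K) ∘ₗ T.proj.compRight K ∘ₗ T.transport

theorem Splitting.inc_comp_coeffs (x : H) : T.inc ∘ₗ T.coeffs x =
    T.ps (bernoulliPowerSeries K) (T.proj ∘ₗ T.transport x) :=
  T.ps_inc _ _ (T.proj_comp_proj _)

theorem Splitting.ps_expQuot_coeffs (x : H) :
    T.ps (expQuot K) (T.inc ∘ₗ T.coeffs x) = T.proj ∘ₗ T.transport x := by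
  rw [T.inc_comp_coeffs, ← T.ps_mul, mul_comm, bernoulli_mul_expQuot, T.ps_one]

theorem Splitting.transport_isHomOfDeg {p : ℤ} {x : H} (hx : x ∈ S.gr p) :
    IsHomOfDeg 𝒱 S.gr p (T.transport x) :=
  T.ps_isHomOfDeg _ (cst_isHomOfDeg S 𝒱 hx)

theorem Splitting.coeffs_isHomOfDeg {p : ℤ} {x : H} (hx : x ∈ S.gr p) :
    IsHomOfDeg 𝒱 𝒱 p (T.coeffs x) := fun i c hc =>
  T.pr_mem (T.ps_isHomOfDeg _ (f := T.proj ∘ₗ T.transport x)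
    (fun i c hc => T.inc_mem (T.pr_mem (T.transport_isHomOfDeg hx i c hc))) i c hc)

/-- The derivative of `e^R x` along the coderivation `Q_φ` is `[e^R x, c(R) φ]`, where
`c(t) = (e^t - 1) / t`. -/
theorem Splitting.transport_comp_coder {q : ℤ} {Q : Module.End K (SymCoalg 𝒱)}
    (hQ : Q ∈ coderComp 𝒱 q) {u : SymCoalg 𝒱 →ₗ[K] H} (hu : T.pt ∘ₗ Q = u) (x : H) :
    T.transport x ∘ₗ Q = gconv S 𝒱 q (T.transport x) (T.ps (expQuot K) u) := by
  let _ : TopologicalSpace H := ⊥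
  have _ : DiscreteTopology H := ⟨rfl⟩
  ext c
  have h1 := T.hasSum_ps (PowerSeries.exp K) (cst 𝒱 x) (Q c)
  have h0 : cst 𝒱 x ∘ₗ Q = 0 := by
    ext c; simp [counit_coder hQ]
  rw [← hasSum_nat_add_iff' 1] at h1
  have h2 := T.hasSum_gconv (PowerSeries.exp K) (expQuot K) q (cst 𝒱 x) u c
  have e : ∀ k, PowerSeries.coeff (k + 1) (PowerSeries.exp K) •
      (T.adPt ^ (k + 1)) (cst 𝒱 x) (Q c) = ∑ y ∈ antidiagonal k,
      (PowerSeries.coeff y.1 (PowerSeries.exp K) * PowerSeries.coeff y.2 (expQuot K)) •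
      gconv S 𝒱 q ((T.adPt ^ y.1) (cst 𝒱 x)) ((T.adPt ^ y.2) u) c := by
    intro k
    have := LinearMap.congr_fun (T.adPt_pow_comp_coder hQ hu (cst 𝒱 x) k) c
    rw [h0, map_zero, zero_add, LinearMap.comp_apply] at this
    rw [this, LinearMap.sum_apply, smul_sum]
    refine sum_congr rfl fun y hy => ?_
    rw [LinearMap.smul_apply, ← Nat.cast_smul_eq_nsmul K, smul_smul, coeff_exp_eq, coeff_exp_eq,
      expQuot, PowerSeries.coeff_mk, ← mem_antidiagonal.1 hy, choose_div_factorial]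
  simp only [e] at h1
  have h3 := h1.unique h2
  have h4 : cst 𝒱 x (Q c) = 0 := LinearMap.congr_fun h0 c
  simp only [range_one, sum_singleton, pow_zero, Module.End.one_apply, h4, smul_zero,
    sub_zero] at h3
  exact h3

/-- `e^R` is an automorphism of the bracket. -/
theorem Splitting.gconv_transport {q : ℤ} (x : H) {y : H} (hy : y ∈ S.gr q) :
    gconv S 𝒱 q (T.transport x) (T.transport y) = T.transport (S.bracket x y) := by
  let _ : TopologicalSpace H := ⊥
  have _ : DiscreteTopology H := ⟨rfl⟩
  ext c
  change _ = T.ps (PowerSeries.exp K) (cst 𝒱 (S.bracket x y)) c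
  refine (T.hasSum_gconv (PowerSeries.exp K) (PowerSeries.exp K) q (cst 𝒱 x) (cst 𝒱 y) c).unique ?_
  have h := T.hasSum_ps (PowerSeries.exp K) (cst 𝒱 (S.bracket x y)) c
  have e0 : cst 𝒱 (S.bracket x y) = gconv S 𝒱 q (cst 𝒱 x) (cst 𝒱 y) := by
    rw [gconv_eq, cst_comp_tw, conv_cst_cst]
  convert h using 2 with k
  rw [e0, T.adPt_pow_gconv _ (cst_isHomOfDeg S 𝒱 hy), LinearMap.sum_apply, smul_sum]
  refine sum_congr rfl fun z hz => ?_
  rw [LinearMap.smul_apply, ← Nat.cast_smul_eq_nsmul K, smul_smul, coeff_exp_eq, coeff_exp_eq,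
    coeff_exp_eq, ← mem_antidiagonal.1 hz]
  rw [Nat.choose_symm_add]
  congr 1
  have h' : ((z.1 + z.2).choose z.2 : K) * z.1.factorial * z.2.factorial =
      (z.1 + z.2).factorial := by
    exact_mod_cast Nat.add_choose_mul_factorial_mul_factorial z.1 z.2
  have := Nat.cast_ne_zero (R := K).2 (Nat.factorial_ne_zero z.1)
  have := Nat.cast_ne_zero (R := K).2 (Nat.factorial_ne_zero z.2)
  have := Nat.cast_ne_zero (R := K).2 (Nat.factorial_ne_zero (z.1 + z.2))
  field_simp
  linear_combination -h'

/-- The Maurer-Cartan equation for `c(R) u`, with `c(t) = (e^t - 1) / t`: the `uᵢ` are the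
derivatives of the generic point along the coderivations `Qᵢ`. -/
theorem Splitting.maurerCartan {p q : ℤ} {Q₁ Q₂ : Module.End K (SymCoalg 𝒱)}
    (h₁ : Q₁ ∈ coderComp 𝒱 p) (h₂ : Q₂ ∈ coderComp 𝒱 q) {u₁ u₂ : SymCoalg 𝒱 →ₗ[K] H}
    (hu₁ : T.pt ∘ₗ Q₁ = u₁) (hu₂ : T.pt ∘ₗ Q₂ = u₂) :
    T.ps (expQuot K) u₁ ∘ₗ Q₂ - (-1 : K) ^ (p * q) • (T.ps (expQuot K) u₂ ∘ₗ Q₁) =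
      T.ps (expQuot K) (u₁ ∘ₗ Q₂ - (-1 : K) ^ (p * q) • (u₂ ∘ₗ Q₁)) +
        gconv S 𝒱 q (T.ps (expQuot K) u₁) (T.ps (expQuot K) u₂) := by
  let _ : TopologicalSpace H := ⊥
  have _ : DiscreteTopology H := ⟨rfl⟩
  have _ : ContinuousConstSMul K H := ⟨fun _ => continuous_of_discreteTopology⟩
  have d₁ : IsHomOfDeg 𝒱 S.gr p u₁ := fun i x hx => by
    subst hu₁
    simpa using T.pt_isHomOfDeg _ _ (h₁.1 i x hx)
  have d₂ : IsHomOfDeg 𝒱 S.gr q u₂ := fun i x hx => by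
    subst hu₂
    simpa using T.pt_isHomOfDeg _ _ (h₂.1 i x hx)
  ext c
  set s := (-1 : K) ^ (p * q) with hs
  set w := u₁ ∘ₗ Q₂ - s • (u₂ ∘ₗ Q₁) with hw
  rw [LinearMap.add_apply, ← sub_eq_iff_eq_add']
  have a1 := T.hasSum_ps (expQuot K) u₁ (Q₂ c)
  have a2 := (T.hasSum_ps (expQuot K) u₂ (Q₁ c)).const_smul s
  have a3 := T.hasSum_ps (expQuot K) w c
  have a4 := T.hasSum_gconv (expQuot K) (expQuot K) q u₁ u₂ c
  have a5 := (a1.sub a2).sub a3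
  rw [← hasSum_nat_add_iff' 1] at a5
  have e : ∀ k, PowerSeries.coeff (k + 1) (expQuot K) • (T.adPt ^ (k + 1)) u₁ (Q₂ c) -
      s • PowerSeries.coeff (k + 1) (expQuot K) • (T.adPt ^ (k + 1)) u₂ (Q₁ c) -
      PowerSeries.coeff (k + 1) (expQuot K) • (T.adPt ^ (k + 1)) w c =
      ∑ y ∈ antidiagonal k,
      (PowerSeries.coeff y.1 (expQuot K) * PowerSeries.coeff y.2 (expQuot K)) •
      gconv S 𝒱 q ((T.adPt ^ y.1) u₁) ((T.adPt ^ y.2) u₂) c := by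
    intro k
    have b1 := LinearMap.congr_fun (T.adPt_pow_comp_coder h₂ hu₂ u₁ k) c
    have b2 := LinearMap.congr_fun (T.adPt_pow_comp_coder h₁ hu₁ u₂ k) c
    rw [← Finset.Nat.sum_antidiagonal_swap] at b2
    have b3 : ∀ y : ℕ × ℕ, gconv S 𝒱 p ((T.adPt ^ y.2) u₂) ((T.adPt ^ y.1) u₁) c =
        -(s • gconv S 𝒱 q ((T.adPt ^ y.1) u₁) ((T.adPt ^ y.2) u₂) c) := fun y => by
      rw [gconv_skew (T.adPt_pow_isHomOfDeg d₂ _) (T.adPt_pow_isHomOfDeg d₁ _), mul_comm q p]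
      simp [hs]
    simp only [LinearMap.comp_apply, LinearMap.add_apply, LinearMap.sum_apply,
      LinearMap.smul_apply, Prod.fst_swap, Prod.snd_swap, b3] at b1 b2
    rw [b1, b2, hw, map_sub, map_smul, LinearMap.sub_apply, LinearMap.smul_apply]
    have b4 : ∑ y ∈ antidiagonal k, (PowerSeries.coeff y.1 (expQuot K) *
        PowerSeries.coeff y.2 (expQuot K)) •
        gconv S 𝒱 q ((T.adPt ^ y.1) u₁) ((T.adPt ^ y.2) u₂) c =
        PowerSeries.coeff (k + 1) (expQuot K) • ∑ y ∈ antidiagonal k, (k + 1).choose (y.2 + 1) •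
          gconv S 𝒱 q ((T.adPt ^ y.1) u₁) ((T.adPt ^ y.2) u₂) c -
        s • PowerSeries.coeff (k + 1) (expQuot K) • ∑ y ∈ antidiagonal k,
          (k + 1).choose (y.1 + 1) •
          -(s • gconv S 𝒱 q ((T.adPt ^ y.1) u₁) ((T.adPt ^ y.2) u₂) c) := by
      simp only [smul_sum]
      rw [← sum_sub_distrib]
      refine sum_congr rfl fun y hy => ?_
      have hss : s * s = 1 := neg_one_zpow_mul_self _
      have hc := choose_add_choose_div_factorial (K := K) y.1 y.2
      rw [mem_antidiagonal.1 hy] at hc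
      simp only [expQuot, PowerSeries.coeff_mk, ← Nat.cast_smul_eq_nsmul K]
      rw [← hc]
      match_scalars
      linear_combination (-((k + 2).factorial : K)⁻¹ * ((k + 1).choose (y.1 + 1) : K)) * hss
    rw [b4]
    simp only [smul_add, smul_sub, smul_comm s]
    abel
  simp only [e] at a5
  have h := a5.unique a4
  have z : ∀ r : K, r • u₁ (Q₂ c) - s • r • u₂ (Q₁ c) - r • (u₁ (Q₂ c) - s • u₂ (Q₁ c)) = 0 :=
    fun r => by module
  simpa [hw, z] using h

/-- The coderivation `Q_{φ(x)}` of `SV` attached to `x ∈ H`. -/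
noncomputable def Splitting.coder : H →ₗ[K] Module.End K (SymCoalg 𝒱) :=
  coderOf 𝒱 ∘ₗ T.coeffs

theorem Splitting.coder_mem {p : ℤ} {x : H} (hx : x ∈ S.gr p) : T.coder x ∈ coderComp 𝒱 p :=
  coderOf_mem_coderComp 𝒱 (T.coeffs_isHomOfDeg hx)

theorem Splitting.proj_coder (x : H) (c : SymCoalg 𝒱) :
    SymCoalg.proj 𝒱 (T.coder x c) = T.coeffs x c :=
  proj_coderOf 𝒱 _ c

/-- `x ↦ Q_{φ(x)}` is compatible with brackets. With `F_x = e^R x`, the derivative of `P F_x` along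
`Q_{φ(y)}` is `P [F_x, P F_y]`; the Maurer-Cartan equation for `P F_x = c(R) φ(x)` then identifies
`c(R)` of the corestriction of the commutator with `P [F_x, F_y] = P F_{[x, y]}`. -/
theorem Splitting.coder_bracket {p q : ℤ} {x y : H} (hx : x ∈ S.gr p) (hy : y ∈ S.gr q) :
    T.coder x * T.coder y - (-1 : K) ^ (p * q) • (T.coder y * T.coder x) =
      T.coder (S.bracket x y) := by
  have h₁ := T.coder_mem hx
  have h₂ := T.coder_mem hy
  refine coder_ext (coderComp_closed 𝒱 p q _ _ h₁ h₂) (T.coder_mem (S.bracket_mem hx hy))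
    fun c => ?_
  have hu₁ : T.pt ∘ₗ T.coder x = T.inc ∘ₗ T.coeffs x := T.pt_comp_coderOf _
  have hu₂ : T.pt ∘ₗ T.coder y = T.inc ∘ₗ T.coeffs y := T.pt_comp_coderOf _
  have e1 := T.transport_comp_coder h₂ hu₂ x
  have e2 := T.transport_comp_coder h₁ hu₁ y
  have e3 := T.maurerCartan h₁ h₂ hu₁ hu₂
  have e4 := T.proj_gconv q (T.transport x) (T.transport y)
  have d₁ : IsHomOfDeg 𝒱 S.gr p (T.proj ∘ₗ T.transport x) :=
    fun i c hc => T.inc_mem (T.pr_mem (T.transport_isHomOfDeg hx i c hc))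
  have e5 := gconv_skew (T.transport_isHomOfDeg hy) d₁
  have hss : (-1 : K) ^ (p * q) * (-1 : K) ^ (p * q) = 1 := neg_one_zpow_mul_self _
  rw [T.ps_expQuot_coeffs] at e1 e2
  rw [T.ps_expQuot_coeffs, T.ps_expQuot_coeffs, LinearMap.comp_assoc, LinearMap.comp_assoc, e1, e2,
    e5, mul_comm q p, LinearMap.comp_neg, LinearMap.comp_smul, smul_neg, smul_smul, hss, one_smul,
    sub_neg_eq_add, ← sub_eq_iff_eq_add, e4, T.gconv_transport x hy] at e3
  -- apply the inverse power series `b = c⁻¹`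
  have e6 := congrArg (T.ps (bernoulliPowerSeries K)) e3
  rw [← T.inc_comp_coeffs, ← T.ps_mul, bernoulli_mul_expQuot, T.ps_one] at e6
  have e7 := congrArg T.pr (LinearMap.congr_fun e6 c)
  simp only [LinearMap.comp_apply, LinearMap.sub_apply, LinearMap.smul_apply, map_sub, map_smul,
    T.pr_inc] at e7
  simp only [LinearMap.sub_apply, LinearMap.smul_apply, Module.End.mul_apply, map_sub, map_smul,
    T.proj_coder, e7]

end Derived

/-! ### Koszul signs and the Taylor coefficients -/

section Permutations

/-- The permutation of `{0, …, n}` that sends the last element to `i` and is given by `σ` on the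
other elements. -/
def insertLast {n : ℕ} (i : Fin (n + 1)) (σ : Equiv.Perm (Fin n)) : Equiv.Perm (Fin (n + 1)) :=
  (finSuccEquiv' (Fin.last n)).trans ((Equiv.optionCongr σ).trans (finSuccEquiv' i).symm)

@[simp] theorem insertLast_last {n : ℕ} (i : Fin (n + 1)) (σ : Equiv.Perm (Fin n)) :
    insertLast i σ (Fin.last n) = i := by
  simp [insertLast]

@[simp] theorem insertLast_castSucc {n : ℕ} (i : Fin (n + 1)) (σ : Equiv.Perm (Fin n))
    (j : Fin n) : insertLast i σ j.castSucc = i.succAbove (σ j) := by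
  have h : finSuccEquiv' (Fin.last n) j.castSucc = some j := by
    rw [← Fin.succAbove_last_apply]
    exact finSuccEquiv'_succAbove _ _
  simp [insertLast, h]

theorem sum_perm_succ {Z : Type*} [AddCommMonoid Z] {n : ℕ} (F : Equiv.Perm (Fin (n + 1)) → Z) :
    ∑ σ, F σ = ∑ i, ∑ σ, F (insertLast i σ) := by
  rw [← Fintype.sum_prod_type']
  refine (Function.Bijective.sum_comp (e := fun x : Fin (n + 1) × Equiv.Perm (Fin n) =>
    insertLast x.1 x.2) ?_ F).symm
  rw [Fintype.bijective_iff_injective_and_card]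
  constructor
  · rintro ⟨i, σ⟩ ⟨j, τ⟩ h
    have hij : i = j := by simpa using congrArg (· (Fin.last n)) h
    subst hij
    refine Prod.ext rfl (Equiv.ext fun k => ?_)
    simpa using congrArg (· k.castSucc) h
  · simp [Fintype.card_perm, Nat.factorial_succ]

/-- The Koszul sign of moving the `i`-th of finitely many homogeneous elements to the end. -/
def lastSign (K : Type*) [Field K] {n : ℕ} (d : Fin n → ℤ) (i : Fin n) : K :=
  ∏ j, if i < j then (-1 : K) ^ (d i * d j) else 1

theorem koszulSign_insertLast (K : Type*) [Field K] {n : ℕ} (d : Fin (n + 1) → ℤ)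
    (i : Fin (n + 1)) (σ : Equiv.Perm (Fin n)) :
    koszulSign K d (insertLast i σ) =
      lastSign K d i * koszulSign K (fun j => d (i.succAbove j)) σ := by
  have h1 : lastSign K d i =
      ∏ j, if i < i.succAbove (σ j) then (-1 : K) ^ (d i * d (i.succAbove (σ j))) else 1 := by
    rw [lastSign, Fin.prod_univ_succAbove _ i, Equiv.prod_comp σ fun j =>
      if i < i.succAbove j then (-1 : K) ^ (d i * d (i.succAbove j)) else 1]
    simp
  have h2 : ∀ j : Fin (n + 1), ¬ Fin.last n < j := fun j => not_lt.2 (Fin.le_last j)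
  simp only [koszulSign, Fin.prod_univ_castSucc, insertLast_castSucc, insertLast_last,
    Fin.castSucc_lt_castSucc_iff, Fin.castSucc_lt_last, h2, false_and, if_false,
    Finset.prod_const_one, mul_one, true_and, Finset.prod_mul_distrib,
    Fin.succAbove_lt_succAbove_iff]
  rw [h1, mul_comm]
  simp only [mul_comm (d i)]

end Permutations

section Taylor

variable {K V H : Type*} [Field K] [AddCommGroup V] [Module K V]
variable [AddCommGroup H] [Module K H]
variable {S : GradedLieAlgebra K H} {𝒱 : ℤ → Submodule K V}

open SymCoalg

theorem ofFn_prod_eq_word {n : ℕ} (d : Fin n → ℤ) (a : Fin n → V) :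
    (List.ofFn fun j => ι 𝒱 (a j)).prod = word 𝒱 (List.ofFn fun j => (d j, a j)) := by
  simp [word, List.map_ofFn, Function.comp_def]

theorem isHomList_ofFn {n : ℕ} {d : Fin n → ℤ} {a : Fin n → V} (ha : ∀ j, a j ∈ 𝒱 (d j)) :
    IsHomList 𝒱 (List.ofFn fun j => (d j, a j)) := by
  intro p hp
  obtain ⟨j, rfl⟩ := (List.mem_ofFn' _ _).1 hp
  exact ha j

variable [DirectSum.Decomposition 𝒱] (T : Splitting S 𝒱)

theorem tw_ofFn_prod (m : ℤ) {n : ℕ} {d : Fin n → ℤ} {a : Fin n → V} (ha : ∀ j, a j ∈ 𝒱 (d j)) :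
    tw 𝒱 m (List.ofFn fun j => ι 𝒱 (a j)).prod =
      (∏ j, (-1 : K) ^ (m * d j)) • (List.ofFn fun j => ι 𝒱 (a j)).prod := by
  induction n with
  | zero => simp
  | succ n ih =>
    rw [List.ofFn_succ, List.prod_cons, tw_ι_mul 𝒱 m (ha 0), ih fun j => ha j.succ,
      Fin.prod_univ_succ, mul_smul_comm, smul_smul]

/-- `R f` at a product of `n + 1` elements: one of them is moved to the end and bracketed with. -/
theorem Splitting.adPt_ofFn_prod (f : SymCoalg 𝒱 →ₗ[K] H) {n : ℕ} {d : Fin (n + 1) → ℤ}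
    {a : Fin (n + 1) → V} (ha : ∀ j, a j ∈ 𝒱 (d j)) :
    T.adPt f (List.ofFn fun j => ι 𝒱 (a j)).prod =
      ∑ i, lastSign K d i •
        S.bracket (f (List.ofFn fun j => ι 𝒱 (a (i.succAbove j))).prod) (T.inc (a i)) := by
  induction n generalizing f with
  | zero =>
    have h := conv_ι_mul S 𝒱 f T.pt (ha 0) 1
    rw [mul_one] at h
    simp [T.adPt_eq, h, T.pt_comp_mulι, conv_cst, lastSign, T.pt_one]
  | succ n ih =>
    rw [List.ofFn_succ, List.prod_cons, T.adPt_eq, conv_ι_mul S 𝒱 _ _ (ha 0), T.pt_comp_mulι,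
      conv_cst, ← T.adPt_eq, ih _ (d := fun j => d j.succ) fun j => ha j.succ,
      Fin.sum_univ_succ (n := n + 1), add_comm]
    congr 1
    · simp only [LinearMap.comp_apply, tw_ofFn_prod _ fun j => ha (Fin.succ j), map_smul,
        LinearMap.flip_apply, lastSign, Fin.prod_univ_succ]
      simp
    · refine Finset.sum_congr rfl fun i _ => ?_
      rw [LinearMap.comp_apply, List.ofFn_succ, List.prod_cons, Fin.succ_succAbove_zero]
      simp only [lastSign, Fin.prod_univ_succ (n := n + 1), Fin.succ_succAbove_succ,
        Fin.succ_lt_succ_iff, LinearMap.mulLeft_apply]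
      simp

/-- If `f` is the graded symmetrization of `g` on words of length `k`, then `R^j f` is the graded
symmetrization of the iterated bracket on words of length `k + j`. -/
theorem Splitting.adPt_pow_ofFn_prod (f : SymCoalg 𝒱 →ₗ[K] H) (g : List H → H) {k : ℕ}
    (hf : ∀ (d : Fin k → ℤ) (a : Fin k → V), (∀ j, a j ∈ 𝒱 (d j)) →
      f (List.ofFn fun j => ι 𝒱 (a j)).prod =
        ∑ σ, koszulSign K d σ • g (List.ofFn fun j => T.inc (a (σ j)))) (j : ℕ)
    (d : Fin (k + j) → ℤ) (a : Fin (k + j) → V) (ha : ∀ j, a j ∈ 𝒱 (d j)) :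
    (T.adPt ^ j) f (List.ofFn fun j => ι 𝒱 (a j)).prod = ∑ σ, koszulSign K d σ •
      nest S (g ((List.ofFn fun j => T.inc (a (σ j))).take k))
        ((List.ofFn fun j => T.inc (a (σ j))).drop k) := by
  induction j with
  | zero =>
    refine (hf d a ha).trans (Finset.sum_congr rfl fun σ _ => ?_)
    rw [List.take_of_length_le (by simp), List.drop_of_length_le (by simp)]
    rfl
  | succ j ih =>
    rw [pow_succ', Module.End.mul_apply]
    refine (T.adPt_ofFn_prod _ (n := k + j) ha).trans (Eq.trans ?_ (sum_perm_succ _).symm)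
    refine Finset.sum_congr rfl fun i _ => ?_
    rw [ih (fun l => d (i.succAbove l)) (fun l => a (i.succAbove l)) fun l => ha _, map_sum,
      LinearMap.sum_apply, Finset.smul_sum]
    refine Finset.sum_congr rfl fun σ _ => ?_
    rw [koszulSign_insertLast, map_smul, LinearMap.smul_apply, smul_smul]
    congr 1
    have h : (List.ofFn fun l => T.inc (a (insertLast i σ l))) =
        (List.ofFn fun l => T.inc (a (i.succAbove (σ l)))) ++ [T.inc (a i)] := by
      rw [List.ofFn_succ']
      simp
    refine Eq.trans ?_ (congrArg (fun l => nest S (g (l.take k)) (l.drop k)) h.symm)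
    rw [List.take_append_of_le_length (by simp), List.drop_append_of_le_length (by simp)]
    simp [nest]

theorem Splitting.adPt_pow_cst_word_eq_zero (k : ℕ) (x : H) {l : List (ℤ × V)}
    (hl : IsHomList 𝒱 l) (hk : l.length ≠ k) : (T.adPt ^ k) (cst 𝒱 x) (word 𝒱 l) = 0 := by
  induction k generalizing l with
  | zero =>
    cases l with
    | nil => simp at hk
    | cons p l => simp
  | succ k ih =>
    rw [pow_succ', Module.End.mul_apply, T.adPt_eq, conv_apply]
    refine cv_word_eq_zero hl fun l₁ l₂ h₁ h₂ h => ?_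
    rcases eq_or_ne l₂.length 1 with h' | h'
    · simp [ih h₁ (by omega)]
    · simp [T.pt_word_eq_zero h']

variable [CharZero K]

theorem Splitting.transport_ofFn_prod (x : H) {n : ℕ} (d : Fin n → ℤ) (a : Fin n → V)
    (ha : ∀ j, a j ∈ 𝒱 (d j)) :
    T.transport x (List.ofFn fun j => ι 𝒱 (a j)).prod =
      ∑ σ, koszulSign K d σ • (n.factorial : K)⁻¹ •
        nest S x (List.ofFn fun j => T.inc (a (σ j))) := by
  have h1 : T.transport x (List.ofFn fun j => ι 𝒱 (a j)).prod = (n.factorial : K)⁻¹ •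
      (T.adPt ^ n) (cst 𝒱 x) (List.ofFn fun j => ι 𝒱 (a j)).prod := by
    rw [Splitting.transport, LinearMap.comp_apply, T.ps_apply, finsum_eq_single _ n, coeff_exp_eq]
    intro k hk
    rw [ofFn_prod_eq_word d, T.adPt_pow_cst_word_eq_zero k x (isHomList_ofFn ha)
      (by simpa using hk.symm), smul_zero]
  have h2 := T.adPt_pow_ofFn_prod (cst 𝒱 x) (fun _ => x) (k := 0) (fun d a _ => by
    simp [koszulSign]) n
  rw [Nat.zero_add] at h2
  rw [h1, h2 d a ha, Finset.smul_sum]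
  refine Finset.sum_congr rfl fun σ _ => ?_
  rw [smul_comm]
  rfl

/-- The corestriction `φ(x)` has the higher derived brackets as its Taylor coefficients. -/
theorem Splitting.inc_coeffs_ofFn_prod (x : H) {n : ℕ} (d : Fin n → ℤ) (a : Fin n → V)
    (ha : ∀ j, a j ∈ 𝒱 (d j)) :
    T.inc (T.coeffs x (List.ofFn fun j => ι 𝒱 (a j)).prod) =
      bracketElem S T.proj x d fun j => T.inc (a j) := by
  have h1 := LinearMap.congr_fun (T.inc_comp_coeffs x) (List.ofFn fun j => ι 𝒱 (a j)).prod
  rw [LinearMap.comp_apply] at h1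
  rw [h1, T.ps_apply, finsum_eq_sum_of_support_subset (s := Finset.range (n + 1)) _ ?_]
  · have h2 : ∀ k ∈ Finset.range (n + 1), (T.adPt ^ (n - k)) (T.proj ∘ₗ T.transport x)
        (List.ofFn fun j => ι 𝒱 (a j)).prod = ∑ σ, koszulSign K d σ • (k.factorial : K)⁻¹ •
        nest S (T.proj (nest S x ((List.ofFn fun j => T.inc (a (σ j))).take k)))
          ((List.ofFn fun j => T.inc (a (σ j))).drop k) := by
      intro k hk
      have h3 := T.adPt_pow_ofFn_prod (T.proj ∘ₗ T.transport x)
        (fun l => (k.factorial : K)⁻¹ • T.proj (nest S x l)) (k := k) (fun d a ha => by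
          rw [LinearMap.comp_apply, T.transport_ofFn_prod x d a ha, map_sum]
          simp only [map_smul]) (n - k)
      rw [Nat.add_sub_cancel' (Nat.lt_succ_iff.1 (Finset.mem_range.1 hk))] at h3
      rw [h3 d a ha]
      refine Finset.sum_congr rfl fun σ _ => ?_
      congr 1
      have h4 : ∀ (l : List H) (r : K) (y : H), nest S (r • y) l = r • nest S y l := by
        intro l r
        induction l with
        | nil => exact fun _ => rfl
        | cons b l ih => intro y; simpa [nest] using ih (S.bracket y b)
      exact h4 _ _ _
    rw [← Finset.sum_range_reflect, bracketElem, ← Nat.range_succ_eq_Icc_zero]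
    simp only [Finset.smul_sum]
    rw [Finset.sum_comm]
    refine Finset.sum_congr rfl fun k hk => ?_
    rw [Nat.add_sub_cancel, h2 k hk, Finset.smul_sum]
    refine Finset.sum_congr rfl fun σ _ => ?_
    rw [smul_smul, smul_smul, smul_smul]
    congr 1
    simp only [bernoulliPowerSeries, PowerSeries.coeff_mk, map_div₀, eq_ratCast, map_natCast]
    ring
  · intro k hk
    by_contra h
    refine hk ?_
    simp only
    rw [ofFn_prod_eq_word d, T.adPt_pow_word_eq_zero k _ (isHomList_ofFn ha) (by simpa using h),
      smul_zero]

end Taylor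

/-! ### The morphism to `Coder(SV)` -/

section Morphism

variable {K V H : Type*} [Field K] [CharZero K] [AddCommGroup V] [Module K V]
variable [AddCommGroup H] [Module K H]
variable {S : GradedLieAlgebra K H} {𝒱 : ℤ → Submodule K V} [DirectSum.Decomposition 𝒱]
variable (T : Splitting S 𝒱)

open SymCoalg

/-- The coderivation attached to `x ∈ H`, as an element of `Coder(SV)`: the homogeneous components
of `x` are treated separately. -/
noncomputable def Splitting.toCoder : H →ₗ[K] Coder 𝒱 :=
  DirectSum.toModule K ℤ _ (fun p => DirectSum.lof K ℤ (fun n => coderComp 𝒱 n) p ∘ₗ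
    (T.coder ∘ₗ (S.gr p).subtype).codRestrict (coderComp 𝒱 p) fun x => T.coder_mem x.2) ∘ₗ
    (DirectSum.decomposeLinearEquiv S.gr).toLinearMap

theorem Splitting.toCoder_of_mem {p : ℤ} {x : H} (hx : x ∈ S.gr p) :
    T.toCoder x = DirectSum.lof K ℤ (fun n => coderComp 𝒱 n) p ⟨T.coder x, T.coder_mem hx⟩ := by
  lift x to S.gr p using hx
  simp [Splitting.toCoder]
  rfl

theorem Splitting.toEnd_toCoder (x : H) : toEnd (coderComp 𝒱) (T.toCoder x) = T.coder x := by
  induction x using DirectSum.Decomposition.inductionOn S.gr with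
  | zero => simp
  | add x y hx hy => simp only [map_add, hx, hy]
  | homogeneous x =>
    rw [T.toCoder_of_mem x.2, toEnd, DirectSum.coeLinearMap_lof]

theorem Splitting.toCoder_isGradedLieHom : IsGradedLieHom S (coderLie 𝒱) T.toCoder := by
  refine ⟨fun n x hx => ⟨_, (T.toCoder_of_mem hx).symm⟩, fun x y => ?_⟩
  induction x using DirectSum.Decomposition.inductionOn S.gr with
  | zero => simp
  | add x x' hx hx' => simp only [map_add, LinearMap.add_apply, hx, hx']
  | homogeneous x =>
    induction y using DirectSum.Decomposition.inductionOn S.gr with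
    | zero => simp
    | add y y' hy hy' => simp only [map_add, hy, hy']
    | homogeneous y =>
      rw [T.toCoder_of_mem x.2, T.toCoder_of_mem y.2,
        T.toCoder_of_mem (S.bracket_mem x.2 y.2)]
      refine Eq.trans ?_ (commBracket_lof (coderComp 𝒱) (coderComp_closed 𝒱) _ _).symm
      exact lof_ext _ rfl _ _ (T.coder_bracket x.2 y.2).symm

end Morphism

/-! ### The semidirect product -/

section SemidirectSplitting

variable {K M : Type*} [Field K] [AddCommGroup M] [Module K M]
variable {G : GradedLieAlgebra K M} (L A : GradedLieSubalgebra G)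

theorem GradedLieSubalgebra.twist_mem (p : ℤ) {x : M} (hx : x ∈ L.carrier) :
    twist G.gr p x ∈ L.carrier := by
  classical
  rw [← DirectSum.sum_support_decompose G.gr x, map_sum]
  refine sum_mem fun i _ => ?_
  rw [twist_of_mem G.gr p (DirectSum.decompose G.gr x i).2]
  exact Submodule.smul_mem _ _ (L.homogeneous i x hx)

theorem toEnd_der_mem (D : Der L) {x : M} (hx : x ∈ L.carrier) :
    toEnd (derComp L) D x ∈ L.carrier := by
  induction D using DirectSum.induction_on with
  | zero => simp
  | of p D =>
    rw [← DirectSum.lof_eq_of K, toEnd, DirectSum.coeLinearMap_lof]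
    exact D.2.2.2 x hx
  | add D E hD hE =>
    rw [map_add, LinearMap.add_apply]
    exact add_mem hD hE

theorem twistedAct_mem (D : Der L) {x : M} (hx : x ∈ L.carrier) :
    twistedAct L D x ∈ L.carrier := by
  induction D using DirectSum.induction_on with
  | zero => simp
  | of p D =>
    rw [← DirectSum.lof_eq_of K, twistedAct, DirectSum.toModule_lof]
    exact D.2.2.2 _ (L.twist_mem p hx)
  | add D E hD hE =>
    rw [map_add, LinearMap.add_apply]
    exact add_mem hD hE

theorem semidirect_bracket (x y : Der L × M) : (semidirect L).bracket x y =
    ((derLie L).bracket x.1 y.1,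
      G.bracket x.2 y.2 + toEnd (derComp L) x.1 y.2 - twistedAct L y.1 x.2) := rfl

variable {L A} (hLA : IsCompl A.carrier L.carrier)

theorem projectionOnto_mem_gr {i : ℤ} {x : M} (hx : x ∈ G.gr i) :
    A.carrier.projectionOnto L.carrier hLA x ∈ A.gr i := by
  set a := A.carrier.projectionOnto L.carrier hLA x with ha
  have hl : x - a ∈ L.carrier := by
    rw [← Submodule.projectionOnto_apply_eq_zero_iff hLA, map_sub,
      Submodule.projectionOnto_apply_left, sub_self]
  have e : (DirectSum.decompose G.gr (a : M) i : M) +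
      (DirectSum.decompose G.gr (x - a) i : M) = x := by
    have := DirectSum.decompose_of_mem_same G.gr hx
    rw [DirectSum.decompose_sub, DirectSum.sub_apply]
    simpa using this
  have h1 := A.homogeneous i _ a.2
  have h2 := L.homogeneous i _ hl
  have h3 : a = ⟨_, h1⟩ := by
    refine (congrArg (A.carrier.projectionOnto L.carrier hLA) e.symm).trans ?_
    rw [map_add, (Submodule.projectionOnto_apply_eq_zero_iff hLA).2 h2, add_zero]
    exact Submodule.projectionOnto_apply_left hLA ⟨_, h1⟩
  rw [h3]
  exact (DirectSum.decompose G.gr (a : M) i).2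

/-- The decomposition `Der(M/L) ⋉ M = A ⊕ (Der(M/L) ⋉ L)`. -/
noncomputable def semidirectSplitting : Splitting (semidirect L) A.gr where
  inc := LinearMap.inr K (Der L) M ∘ₗ A.carrier.subtype
  pr := A.carrier.projectionOnto L.carrier hLA ∘ₗ LinearMap.snd K (Der L) M
  inc_mem hv := ⟨zero_mem _, hv⟩
  pr_mem hx := projectionOnto_mem_gr hLA hx.2
  pr_inc v := Submodule.projectionOnto_apply_left hLA v
  inc_pr_bracket_inc v w := by
    have h : (semidirect L).bracket (0, (v : M)) (0, (w : M)) = (0, G.bracket v w) := by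
      simp [semidirect_bracket]
    have h2 := Submodule.projectionOnto_apply_left hLA
      ⟨G.bracket v w, A.bracket_mem v w v.2 w.2⟩
    exact (congrArg (fun z : Der L × M => LinearMap.inr K (Der L) M
      (A.carrier.projectionOnto L.carrier hLA z.2)) h).trans
        ((congrArg (fun z : A.carrier => LinearMap.inr K (Der L) M z) h2).trans h.symm)
  pr_bracket_of_pr_eq_zero x y hx hy := by
    replace hx := (Submodule.projectionOnto_apply_eq_zero_iff hLA).1 hx
    replace hy := (Submodule.projectionOnto_apply_eq_zero_iff hLA).1 hy
    exact (Submodule.projectionOnto_apply_eq_zero_iff hLA).2 <|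
      sub_mem (add_mem (L.bracket_mem _ _ hx hy) (toEnd_der_mem L _ hy)) (twistedAct_mem L _ hx)

theorem semidirectSplitting_proj (x : Der L × M) : (semidirectSplitting hLA).proj x =
    LinearMap.inr K (Der L) M (A.carrier.projection L.carrier hLA x.2) := rfl

theorem nest_inr (x : M) (l : List M) :
    nest (semidirect L) (LinearMap.inr K (Der L) M x) (l.map (LinearMap.inr K (Der L) M)) =
      LinearMap.inr K (Der L) M (nest G x l) := by
  induction l generalizing x with
  | nil => rfl
  | cons b l ih =>
    have h : (semidirect L).bracket (LinearMap.inr K (Der L) M x) (LinearMap.inr K (Der L) M b) =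
        LinearMap.inr K (Der L) M (G.bracket x b) := by
      simp [semidirect_bracket]
    simpa only [nest, List.map_cons, List.foldl_cons, h] using ih (G.bracket x b)

theorem proj_nest_inl (D : Der L) (l : List M) :
    (semidirectSplitting hLA).proj (nest (semidirect L) (LinearMap.inl K (Der L) M D)
      (l.map (LinearMap.inr K (Der L) M))) =
      LinearMap.inr K (Der L) M (A.carrier.projection L.carrier hLA
        (nestDer G (toEnd (derComp L) D) l)) := by
  cases l with
  | nil => simp [nest, nestDer, semidirectSplitting_proj]
  | cons b l =>
    have h : (semidirect L).bracket (LinearMap.inl K (Der L) M D) (LinearMap.inr K (Der L) M b) =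
        LinearMap.inr K (Der L) M (toEnd (derComp L) D b) := by
      simp [semidirect_bracket]
    have h2 := nest_inr (L := L) (toEnd (derComp L) D b) l
    simp only [nest, nestDer, List.map_cons, List.foldl_cons, h] at h2 ⊢
    rw [h2, semidirectSplitting_proj]
    rfl

/-- On `M`, the brackets of the splitting of `Der(M/L) ⋉ M` are those of `M = A ⊕ L`. -/
theorem bracketElem_inr (m : M) {n : ℕ} (d : Fin n → ℤ) (a : Fin n → A.carrier) :
    bracketElem (semidirect L) (semidirectSplitting hLA).proj (LinearMap.inr K (Der L) M m) d
      (fun j => (semidirectSplitting hLA).inc (a j)) =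
      LinearMap.inr K (Der L) M
        (bracketElem G (A.carrier.projection L.carrier hLA) m d fun j => a j) := by
  have h : ∀ σ : Equiv.Perm (Fin n),
      (List.ofFn fun j => (semidirectSplitting hLA).inc (a (σ j))) =
        (List.ofFn fun j => (a (σ j) : M)).map (LinearMap.inr K (Der L) M) := fun σ => by
    rw [List.map_ofFn]; rfl
  simp only [bracketElem, h, ← List.map_take, ← List.map_drop, nest_inr, semidirectSplitting_proj,
    map_sum, map_smul]
  rfl

theorem nest_zero (l : List M) : nest G 0 l = 0 := by
  induction l with
  | nil => rfl
  | cons b l ih => simpa [nest] using ih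

/-- On `Der(M/L)`, the brackets of the splitting of `Der(M/L) ⋉ M` are the brackets of
derivations, because `[(D, 0), (0, a)] = (0, D a)`. -/
theorem bracketElem_inl (D : Der L) {n : ℕ} (d : Fin n → ℤ) (a : Fin n → A.carrier) :
    bracketElem (semidirect L) (semidirectSplitting hLA).proj (LinearMap.inl K (Der L) M D) d
      (fun j => (semidirectSplitting hLA).inc (a j)) =
      LinearMap.inr K (Der L) M (bracketDer G (A.carrier.projection L.carrier hLA)
        (toEnd (derComp L) D) d fun j => a j) := by
  have h : ∀ σ : Equiv.Perm (Fin n),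
      (List.ofFn fun j => (semidirectSplitting hLA).inc (a (σ j))) =
        (List.ofFn fun j => (a (σ j) : M)).map (LinearMap.inr K (Der L) M) := fun σ => by
    rw [List.map_ofFn]; rfl
  simp only [bracketElem, bracketDer, h, ← List.map_take, ← List.map_drop, proj_nest_inl, nest_inr,
    map_sum, map_smul]
  refine Finset.sum_congr rfl fun σ _ => ?_
  congr 1
  refine (Finset.sum_subset (Finset.Icc_subset_Icc_left zero_le_one) fun k hk hk' => ?_).symm
  -- the term `k = 0` vanishes since `(D, 0)` projects to `0` in `A`
  have hk0 : k = 0 := by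
    rw [Finset.mem_Icc] at hk hk'
    omega
  subst hk0
  simp [nestDer, nest_zero]

end SemidirectSplitting

/-! ### Taylor coefficients -/

section TaylorCoefficients

variable {K M : Type*} [Field K] [CharZero K] [AddCommGroup M] [Module K M]
variable {G : GradedLieAlgebra K M} {L A : GradedLieSubalgebra G}

/-- A coderivation is determined by its Taylor coefficients. -/
theorem HasTaylorCoeffs.iff_eq {Q₀ : Coder A.gr}
    {c : ∀ n : ℕ, (Fin n → ℤ) → (Fin n → M) → M} (h₀ : HasTaylorCoeffs A Q₀ c) (Q : Coder A.gr) :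
    HasTaylorCoeffs A Q c ↔ Q = Q₀ := by
  refine ⟨fun h => SymCoalg.coder_toEnd_ext fun x => ?_, fun h => h ▸ h₀⟩
  refine LinearMap.congr_fun (f := SymCoalg.proj A.gr ∘ₗ toEnd (coderComp A.gr) Q)
    (g := SymCoalg.proj A.gr ∘ₗ toEnd (coderComp A.gr) Q₀)
    (SymCoalg.linearMap_ext_word fun l hl => ?_) x
  have e : SymCoalg.word A.gr l =
      (List.ofFn fun j => SymCoalg.ι A.gr (l.get j).2).prod := by
    rw [SymCoalg.word]
    congr 1
    conv_lhs => rw [← List.ofFn_get l, List.map_ofFn]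
    rfl
  have hl' : ∀ j, (l.get j).2 ∈ A.gr (l.get j).1 := fun j => hl _ (List.get_mem l j)
  rw [e]
  exact Subtype.ext ((h _ _ _ hl').trans (h₀ _ _ _ hl').symm)

theorem hasTaylorCoeffs_elem (hLA : IsCompl A.carrier L.carrier) (m : M) :
    HasTaylorCoeffs A ((semidirectSplitting hLA).toCoder (0, m)) fun _ d a =>
      bracketElem G (A.carrier.projection L.carrier hLA) m d a := by
  intro n d a ha
  rw [Splitting.toEnd_toCoder, Splitting.proj_coder]
  have h := (semidirectSplitting hLA).inc_coeffs_ofFn_prod (0, m) d a ha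
  exact congrArg Prod.snd (h.trans (bracketElem_inr hLA m d a))

theorem hasTaylorCoeffs_der (hLA : IsCompl A.carrier L.carrier) (D : Der L) :
    HasTaylorCoeffs A ((semidirectSplitting hLA).toCoder (D, 0)) fun _ d a =>
      bracketDer G (A.carrier.projection L.carrier hLA) (toEnd (derComp L) D) d a := by
  intro n d a ha
  rw [Splitting.toEnd_toCoder, Splitting.proj_coder]
  have h := (semidirectSplitting hLA).inc_coeffs_ofFn_prod (D, 0) d a ha
  exact congrArg Prod.snd (h.trans (bracketElem_inl hLA D d a))

theorem toEnd_toCoder_der_one (hLA : IsCompl A.carrier L.carrier) (D : Der L) :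
    toEnd (coderComp A.gr) ((semidirectSplitting hLA).toCoder (D, 0)) 1 = 0 := by
  have h := hasTaylorCoeffs_der hLA D 0 Fin.elim0 Fin.elim0 (fun j => j.elim0)
  have h0 : (semidirectSplitting hLA).coeffs (D, 0) 1 = 0 := by
    rw [Splitting.toEnd_toCoder, Splitting.proj_coder] at h
    exact Subtype.ext (by simpa [bracketDer] using h)
  rw [Splitting.toEnd_toCoder, Splitting.coder, LinearMap.comp_apply, SymCoalg.coderOf_one, h0,
    map_zero]

end TaylorCoefficients

end HDB

theorem theorem1p2 {K M : Type*} [Field K] [CharZero K] [AddCommGroup M] [Module K M]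
    (G : HDB.GradedLieAlgebra K M) (L A : HDB.GradedLieSubalgebra G)
    (hLA : IsCompl A.carrier L.carrier) :
    ∃ Φ : HDB.Der L × M →ₗ[K] HDB.Coder A.gr,
      -- `Φ(m)` is the unique coderivation with the higher derived brackets of `m` as coefficients
      (∀ (m : M) (Q : HDB.Coder A.gr),
        HDB.HasTaylorCoeffs A Q (fun _ d a =>
          HDB.bracketElem G (A.carrier.projection L.carrier hLA) m d a) ↔ Q = Φ (0, m)) ∧
      -- `Φ(D)` is the unique coderivation with the higher derived brackets of `D` as coefficients
      (∀ (D : HDB.Der L) (Q : HDB.Coder A.gr),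
        HDB.HasTaylorCoeffs A Q (fun _ d a =>
          HDB.bracketDer G (A.carrier.projection L.carrier hLA)
            (HDB.toEnd (HDB.derComp L) D) d a) ↔ Q = Φ (D, 0)) ∧
      -- `Φ(D)` lies in the coderivations of the reduced symmetric coalgebra
      (∀ D : HDB.Der L, HDB.toEnd (HDB.coderComp A.gr) (Φ (D, 0)) 1 = 0) ∧
      -- `Φ` is a morphism of graded Lie algebras
      HDB.IsGradedLieHom (HDB.semidirect L) (HDB.coderLie A.gr) Φ ∧
      (∀ m₁ m₂ : M, (HDB.coderLie A.gr).bracket (Φ (0, m₁)) (Φ (0, m₂)) =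
        Φ (0, G.bracket m₁ m₂)) ∧
      (∀ D₁ D₂ : HDB.Der L, (HDB.coderLie A.gr).bracket (Φ (D₁, 0)) (Φ (D₂, 0)) =
        Φ ((HDB.derLie L).bracket D₁ D₂, 0)) ∧
      (∀ (D : HDB.Der L) (m : M), (HDB.coderLie A.gr).bracket (Φ (D, 0)) (Φ (0, m)) =
        Φ (0, HDB.toEnd (HDB.derComp L) D m)) := by
  have hom := (HDB.semidirectSplitting hLA).toCoder_isGradedLieHom
  refine ⟨(HDB.semidirectSplitting hLA).toCoder,
    fun m Q => (HDB.hasTaylorCoeffs_elem hLA m).iff_eq Q,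
    fun D Q => (HDB.hasTaylorCoeffs_der hLA D).iff_eq Q,
    HDB.toEnd_toCoder_der_one hLA, hom, fun m₁ m₂ => ?_, fun D₁ D₂ => ?_, fun D m => ?_⟩
  all_goals
    rw [← hom.2]
    simp [HDB.semidirect_bracket]
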